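/- Let $\mathbb H^2_+(\mathbb R)\subset L^2(\mathbb R)$ be the Hardy space of functions analytic in the upper half-plane, identified with their boundary values. A bounded operator $\mathbf H$ in $\mathbb H^2_+(\mathbb R)$ is called the Hankel operator with symbol $\varphi\in L^\infty(\mathbb R)$ if $$(\mathbf H w,w)=\int_{\mathbb R}\varphi(\lambda)\,w(-\lambda)\,\overline{w(\lambda)}\,d\lambda\qquad\text{for all } w\in\mathbb H^2_+(\mathbb R).$$ **Theorem.** Let $\mathbf H$ be a self-adjoint Hankel operator in $\mathbb H^2_+(\mathbb R)$ whose symbol is $$\varphi(z)=\sum_{m=1}^M Q_m(z)\,(\alpha_m-iz)^{-K_m-1},$$ where $M\ge 0$, the numbers $\alpha_m\in\mathbb C$ are pairwise distinct with $\operatorname{Re}\alpha_m>0$, $K_m\in\{0,1,2,\dots\}$, and the $Q_m$ are polynomials with complex coefficients such that $\deg Q_m\le K_m$ and $Q_m(-i\alpha_m)\ne 0$. Then for every $m$ with $\operatorname{Im}\alpha_m=0$ the number $\mathsf p_m:=Q_m(-i\alpha_m)$ is real. For such $m$ set $$\mathcal N_+^{(m)}=\mathcal N_-^{(m)}=\frac{K_m+1}{2}\quad\text{if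 } K_m \text{ is odd},$$ $$\mathcal N_+^{(m)}-1=\mathcal N_-^{(m)}=\frac{K_m}{2}\quad\text{if } K_m\text{ is even and }\mathsf p_m>0,$$ $$\mathcal N_+^{(m)}=\mathcal N_-^{(m)}-1=\frac{K_m}{2}\quad\text{if } K_m\text{ is even and }\mathsf p_m<0.$$ Let $M_1$ be the number of indices $m$ with $\operatorname{Im}\alpha_m>0$. Then the total numbers $N_\pm(\mathbf H)$ of (strictly) positive and negative eigenvalues of $\mathbf H$, counted with multiplicity, are $$N_\pm(\mathbf H)=\sum_{m:\ \operatorname{Im}\alpha_m=0}\mathcal N_\pm^{(m)}+\sum_{m:\ \operatorname{Im}\alpha_m>0}K_m+M_1 .$$ -/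

import Mathlib

open MeasureTheory Filter Topology Polynomial
open scoped ENNReal NNReal

/-- `F` is analytic in the open upper half-plane, belongs to the Hardy class `H²` there
(the `L²`-norms over the horizontal lines `Im z = y`, `y > 0`, are uniformly bounded), and has
boundary value `w ∈ L²(ℝ)` on the real line, attained in the `L²`-sense as `y → 0+`. -/
structure IsHardyExtension (w : Lp ℂ 2 (volume : Measure ℝ)) (F : ℂ → ℂ) : Prop where
  analytic : DifferentiableOn ℂ F {z : ℂ | 0 < z.im}
  bounded : ∃ C : ℝ≥0, ∀ y : ℝ, 0 < y →
    eLpNorm (fun x : ℝ => F ((x : ℂ) + (y : ℂ) * Complex.I)) 2 volume ≤ C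
  boundary : Tendsto
    (fun y : ℝ => eLpNorm (fun x : ℝ => F ((x : ℂ) + (y : ℂ) * Complex.I) - w x) 2 volume)
    (𝓝[>] 0) (𝓝 0)

theorem aestronglyMeasurable_line {F : ℂ → ℂ}
    (hF : DifferentiableOn ℂ F {z : ℂ | 0 < z.im}) {y : ℝ} (hy : 0 < y) :
    AEStronglyMeasurable (fun x : ℝ => F ((x : ℂ) + (y : ℂ) * Complex.I)) volume := by
  refine Continuous.aestronglyMeasurable ?_
  refine hF.continuousOn.comp_continuous (by fun_prop) ?_
  intro x
  simpa using hy

theorem IsHardyExtension.add {w v : Lp ℂ 2 (volume : Measure ℝ)} {F G : ℂ → ℂ}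
    (hF : IsHardyExtension w F) (hG : IsHardyExtension v G) :
    IsHardyExtension (w + v) (F + G) := by
  refine ⟨hF.analytic.add hG.analytic, ?_, ?_⟩
  · obtain ⟨C, hC⟩ := hF.bounded
    obtain ⟨D, hD⟩ := hG.bounded
    refine ⟨C + D, fun y hy => ?_⟩
    refine (eLpNorm_add_le (aestronglyMeasurable_line hF.analytic hy)
      (aestronglyMeasurable_line hG.analytic hy) (by norm_num)).trans ?_
    push_cast
    exact add_le_add (hC y hy) (hD y hy)
  · have hlim := hF.boundary.add hG.boundary
    rw [add_zero] at hlim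
    refine tendsto_of_tendsto_of_tendsto_of_le_of_le' tendsto_const_nhds hlim
      (Eventually.of_forall fun _ => zero_le) ?_
    filter_upwards [self_mem_nhdsWithin] with y hy
    have hy' : 0 < y := hy
    refine le_trans (le_of_eq ?_) (eLpNorm_add_le
      ((aestronglyMeasurable_line hF.analytic hy').sub (Lp.aestronglyMeasurable w))
      ((aestronglyMeasurable_line hG.analytic hy').sub (Lp.aestronglyMeasurable v)) (by norm_num))
    refine eLpNorm_congr_ae ?_
    filter_upwards [Lp.coeFn_add w v] with x hx
    simp only [Pi.add_apply, hx]
    ring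

theorem IsHardyExtension.smul (c : ℂ) {w : Lp ℂ 2 (volume : Measure ℝ)} {F : ℂ → ℂ}
    (hF : IsHardyExtension w F) : IsHardyExtension (c • w) (c • F) := by
  refine ⟨hF.analytic.const_smul c, ?_, ?_⟩
  · obtain ⟨C, hC⟩ := hF.bounded
    refine ⟨‖c‖₊ * C, fun y hy => ?_⟩
    refine (eLpNorm_const_smul_le (c := c)
      (f := fun x : ℝ => F ((x : ℂ) + (y : ℂ) * Complex.I))).trans ?_
    push_cast
    exact mul_le_mul_right (hC y hy) _
  · have hlim := ENNReal.Tendsto.const_mul (a := (‖c‖ₑ)) hF.boundary (Or.inr (by simp))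
    rw [mul_zero] at hlim
    refine hlim.congr fun y => ?_
    rw [← eLpNorm_const_smul]
    refine eLpNorm_congr_ae ?_
    filter_upwards [Lp.coeFn_smul c w] with x hx
    simp only [Pi.smul_apply, hx, smul_sub]

/-- The Hardy space `H²₊(ℝ)` of the upper half-plane, as a subspace of `L²(ℝ)` (a function in
the Hardy class is identified with its boundary value). -/
noncomputable def hardyPlus : Submodule ℂ (Lp ℂ 2 (volume : Measure ℝ)) where
  carrier := {w | ∃ F : ℂ → ℂ, IsHardyExtension w F}
  zero_mem' := by
    refine ⟨0, differentiableOn_const 0, ⟨0, fun y _ => by simp⟩, ?_⟩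
    refine tendsto_const_nhds.congr fun y => ?_
    rw [eq_comm, ← eLpNorm_zero (ε := ℂ) (p := 2) (μ := (volume : Measure ℝ))]
    refine eLpNorm_congr_ae ?_
    filter_upwards [Lp.coeFn_zero ℂ 2 (volume : Measure ℝ)] with x _
    simp
  add_mem' := by
    rintro w v ⟨F, hF⟩ ⟨G, hG⟩
    exact ⟨F + G, hF.add hG⟩
  smul_mem' := by
    rintro c w ⟨F, hF⟩
    exact ⟨c • F, hF.smul c⟩

/-- `H` is the Hankel operator in `H²₊(ℝ)` with symbol `φ ∈ L^∞(ℝ)`: its quadratic form is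
`(H w, w) = ∫ φ(x) w(-x) conj(w(x)) dx`. Mathlib's inner product is linear in the second
argument, so `(H w, w)` is `inner ℂ w (H w)`. -/
structure IsHankelWithSymbol (φ : ℝ → ℂ) (H : hardyPlus →L[ℂ] hardyPlus) : Prop where
  symbol_bounded : MemLp φ ∞ (volume : Measure ℝ)
  form_eq : ∀ w : hardyPlus, inner ℂ w (H w) =
    ∫ x : ℝ, φ x * (w : Lp ℂ 2 (volume : Measure ℝ)) (-x) *
      starRingEnd ℂ ((w : Lp ℂ 2 (volume : Measure ℝ)) x)

/-- The rational function `∑ₘ Qₘ(x) (αₘ - i x)^{-Kₘ-1}`, for real `x`. -/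
noncomputable def rationalSymbol {M : ℕ} (α : Fin M → ℂ) (K : Fin M → ℕ) (Q : Fin M → ℂ[X])
    (x : ℝ) : ℂ :=
  ∑ m, (Q m).eval (x : ℂ) / (α m - Complex.I * (x : ℂ)) ^ (K m + 1)

/-- The number of eigenvalues of `T` lying in the set `S` of real numbers, each eigenvalue
counted with its multiplicity. -/
noncomputable def eigenvalueCount {E : Type*} [AddCommGroup E] [Module ℂ E]
    (T : Module.End ℂ E) (S : Set ℝ) : ℕ∞ :=
  ∑' μ : S, Cardinal.toENat (Module.rank ℂ (Module.End.eigenspace T ((μ : ℝ) : ℂ)))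

/-- The number `N₊` of positive eigenvalues, with multiplicity. -/
noncomputable def numPosEigenvalues {E : Type*} [AddCommGroup E] [Module ℂ E]
    (T : Module.End ℂ E) : ℕ∞ := eigenvalueCount T (Set.Ioi 0)

/-- The number `N₋` of negative eigenvalues, with multiplicity. -/
noncomputable def numNegEigenvalues {E : Type*} [AddCommGroup E] [Module ℂ E]
    (T : Module.End ℂ E) : ℕ∞ := eigenvalueCount T (Set.Iio 0)

/-- The contribution of a real term to `N₊`: it is `(K + 1) / 2` if `K` is odd, `K / 2 + 1` if `K`
is even and `p > 0`, and `K / 2` if `K` is even and `p < 0`. -/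
noncomputable def realTermPos (K : ℕ) (p : ℝ) : ℕ :=
  if Odd K then (K + 1) / 2 else if 0 < p then K / 2 + 1 else K / 2

/-- The contribution of a real term to `N₋`: it is `(K + 1) / 2` if `K` is odd, `K / 2` if `K`
is even and `p > 0`, and `K / 2 + 1` if `K` is even and `p < 0`. -/
noncomputable def realTermNeg (K : ℕ) (p : ℝ) : ℕ :=
  if Odd K then (K + 1) / 2 else if p < 0 then K / 2 + 1 else K / 2

/-! Write a_m = iα_m and v*(x) = conj v(-x). Polarising the definition of H and substituting x ↦ -x
gives (Hw, v) = ∫ φ(-x) w(x) v*(x) dx, where v* is again in H²₊. The poles of φ(-x) are the points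
a_m, all in the upper half-plane and of order K_m + 1, so the form sees only finitely many Taylor
coefficients of w v* at the a_m.

Let B_o be the product of the factors ((z - a_m)/(z + i))^{o_m}. The subspace B_o H²₊ prescribes
zeros of order o_m at a_m and has codimension ∑ o_m. On such subspaces the form becomes a short sum
of residues, with three consequences. The kernel of H is B_{K+1} H²₊, so H has rank ∑ (K_m + 1)
(`ker_hankel_eq`). Self-adjointness forces the α_m to be closed under conjugation σ, with equal
orders, and the leading residue at a real α_m to be real (`exists_conj_pole`, `order_eq_conj`,
`poleCoeff_im_eq_zero`). Finally, if o_m + o_{σm} ≥ K_m, only poles with equality contribute to (Hx,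
x) on B_o H²₊, and a real one contributes its leading residue times a nonnegative number
(`hankel_form_nonneg`).

Now choose o. At a real pole, (K+1)/2 zeros annihilate the contribution when K is odd; when K is
even, K/2 zeros leave one square with the sign of p_m, and one more zero removes it if that sign is
unwanted. For a conjugate pair, all K+1 zeros go to one member. The form is then semidefinite on a
subspace whose codimension is the asserted count for the opposite sign, and eigenvectors of that
sign are independent modulo the subspace. Thus each N_± is at most its asserted value
(`eigenvalueCount_le_finrank_quotient`). The two values add up to the rank, which is at most N_+ +
N_- (`finrank_range_le_eigenvalueCount_add`), so both bounds are equalities. -/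

/-- The function-level version of `IsHardyExtension`, for the Hardy class `H^p`: `F` is analytic in
the upper half-plane, uniformly `L^p`-bounded on horizontal lines, with `L^p`-boundary value `f`. -/
structure IsHardyFun (p : ℝ≥0∞) (f : ℝ → ℂ) (F : ℂ → ℂ) : Prop where
  aesm : AEStronglyMeasurable f volume
  analytic : DifferentiableOn ℂ F {z : ℂ | 0 < z.im}
  bounded : ∃ C : ℝ≥0, ∀ y : ℝ, 0 < y →
    eLpNorm (fun x : ℝ => F ((x : ℂ) + (y : ℂ) * Complex.I)) p volume ≤ C
  boundary : Tendsto
    (fun y : ℝ => eLpNorm (fun x : ℝ => F ((x : ℂ) + (y : ℂ) * Complex.I) - f x) p volume)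
    (𝓝[>] 0) (𝓝 0)

/-- A bounded analytic function in the upper half-plane which extends to the closed half-plane and
is Lipschitz in the vertical direction; such functions multiply Hardy classes into themselves. -/
structure IsMultiplier (m : ℂ → ℂ) : Prop where
  analytic : DifferentiableOn ℂ m {z : ℂ | 0 < z.im}
  cont : Continuous fun x : ℝ => m x
  bounded : ∃ C : ℝ≥0, ∀ z : ℂ, 0 ≤ z.im → ‖m z‖ ≤ C
  lipschitz : ∃ L : ℝ≥0, ∀ x y : ℝ, 0 < y →
    ‖m ((x : ℂ) + (y : ℂ) * Complex.I) - m x‖ ≤ L * y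

/-! ### Hardy classes: products, multipliers, reflection. -/

theorem isOpen_upperHalf : IsOpen {z : ℂ | 0 < z.im} :=
  isOpen_lt continuous_const Complex.continuous_im

theorem line_im (x y : ℝ) : ((x : ℂ) + (y : ℂ) * Complex.I).im = y := by simp

theorem IsHardyExtension.isHardyFun {w : Lp ℂ 2 (volume : Measure ℝ)} {F : ℂ → ℂ}
    (h : IsHardyExtension w F) : IsHardyFun 2 w F :=
  ⟨Lp.aestronglyMeasurable w, h.analytic, h.bounded, h.boundary⟩

theorem IsHardyFun.isHardyExtension {w : Lp ℂ 2 (volume : Measure ℝ)} {F : ℂ → ℂ}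
    (h : IsHardyFun 2 w F) : IsHardyExtension w F :=
  ⟨h.analytic, h.bounded, h.boundary⟩

namespace IsHardyFun

variable {p : ℝ≥0∞} {f g : ℝ → ℂ} {F G : ℂ → ℂ}

theorem congr (h : IsHardyFun p f F) (hfg : f =ᵐ[volume] g) : IsHardyFun p g F := by
  refine ⟨h.aesm.congr hfg, h.analytic, h.bounded, h.boundary.congr fun y => ?_⟩
  refine eLpNorm_congr_ae ?_
  filter_upwards [hfg] with x hx
  rw [hx]

theorem congr_extension (h : IsHardyFun p f F) (hFG : Set.EqOn F G {z : ℂ | 0 < z.im}) :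
    IsHardyFun p f G := by
  have key : ∀ y : ℝ, 0 < y → (fun x : ℝ => G ((x : ℂ) + (y : ℂ) * Complex.I)) =
      fun x : ℝ => F ((x : ℂ) + (y : ℂ) * Complex.I) := fun y hy =>
    funext fun x => (hFG (by simpa using hy)).symm
  refine ⟨h.aesm, h.analytic.congr fun z hz => (hFG hz).symm, ?_, ?_⟩
  · obtain ⟨C, hC⟩ := h.bounded
    exact ⟨C, fun y hy => by rw [key y hy]; exact hC y hy⟩
  · refine h.boundary.congr' ?_
    filter_upwards [self_mem_nhdsWithin] with y hy
    refine congrArg (fun k => eLpNorm k p volume) (funext fun x => ?_)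
    rw [← congrFun (key y hy) x]

theorem line_aesm (h : IsHardyFun p f F) {y : ℝ} (hy : 0 < y) :
    AEStronglyMeasurable (fun x : ℝ => F ((x : ℂ) + (y : ℂ) * Complex.I)) volume :=
  aestronglyMeasurable_line h.analytic hy

theorem line_memLp (h : IsHardyFun p f F) {y : ℝ} (hy : 0 < y) :
    MemLp (fun x : ℝ => F ((x : ℂ) + (y : ℂ) * Complex.I)) p volume := by
  obtain ⟨C, hC⟩ := h.bounded
  exact ⟨h.line_aesm hy, (hC y hy).trans_lt ENNReal.coe_lt_top⟩

/-- Since `f` is only assumed measurable, finiteness is borrowed from a line so low that the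
difference from the boundary value has norm below 1. -/
theorem memLp (h : IsHardyFun p f F) : MemLp f p volume := by
  have h1 := h.boundary.eventually_lt_const (u := 1) (by norm_num)
  obtain ⟨y, hy1, hy⟩ := (h1.and self_mem_nhdsWithin).exists
  have hd : MemLp (fun x : ℝ => F ((x : ℂ) + (y : ℂ) * Complex.I) - f x) p volume :=
    ⟨(h.line_aesm hy).sub h.aesm, hy1.trans (by norm_num)⟩
  have := (h.line_memLp hy).sub hd
  refine this.ae_eq (Eventually.of_forall fun x => ?_)
  simp

theorem add (hF : IsHardyFun p f F) (hG : IsHardyFun p g G) (hp : 1 ≤ p) :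
    IsHardyFun p (fun x => f x + g x) (fun z => F z + G z) := by
  refine ⟨hF.aesm.add hG.aesm, hF.analytic.add hG.analytic, ?_, ?_⟩
  · obtain ⟨C, hC⟩ := hF.bounded
    obtain ⟨D, hD⟩ := hG.bounded
    refine ⟨C + D, fun y hy => ?_⟩
    refine (eLpNorm_add_le (hF.line_aesm hy) (hG.line_aesm hy) hp).trans ?_
    push_cast
    exact add_le_add (hC y hy) (hD y hy)
  · have hlim := hF.boundary.add hG.boundary
    rw [add_zero] at hlim
    refine tendsto_of_tendsto_of_tendsto_of_le_of_le' tendsto_const_nhds hlim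
      (Eventually.of_forall fun _ => zero_le) ?_
    filter_upwards [self_mem_nhdsWithin] with y hy
    refine le_trans (le_of_eq ?_) (eLpNorm_add_le
      ((hF.line_aesm hy).sub hF.aesm) ((hG.line_aesm hy).sub hG.aesm) hp)
    refine congrArg (fun k => eLpNorm k p volume) (funext fun x => ?_)
    simp only [Pi.add_apply]
    ring

/-- Convergence to the boundary value follows from a pointwise estimate. -/
theorem tendsto_boundary_of_le (h : IsHardyFun p f F) (hp : 1 ≤ p) {A : ℝ → ℝ → ℂ} {c L : ℝ≥0}
    (hA : ∀ᶠ y in 𝓝[>] (0 : ℝ), ∀ x : ℝ, ‖A y x‖ ≤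
      c * ‖F ((x : ℂ) + (y : ℂ) * Complex.I) - f x‖ + L * y * ‖f x‖) :
    Tendsto (fun y => eLpNorm (A y) p volume) (𝓝[>] 0) (𝓝 0) := by
  have hf := h.memLp
  have h1 : Tendsto (fun y : ℝ => (c : ℝ≥0∞) *
      eLpNorm (fun x : ℝ => F ((x : ℂ) + (y : ℂ) * Complex.I) - f x) p volume) (𝓝[>] 0)
      (𝓝 0) := by
    have := ENNReal.Tendsto.const_mul (a := (c : ℝ≥0∞)) h.boundary (Or.inr (by simp))
    rwa [mul_zero] at this
  have h2 : Tendsto (fun y : ℝ => ‖(L * y : ℝ)‖ₑ * eLpNorm f p volume) (𝓝[>] 0) (𝓝 0) := by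
    have h3 : Tendsto (fun y : ℝ => ‖(L * y : ℝ)‖ₑ) (𝓝[>] 0) (𝓝 0) := by
      have : Continuous fun y : ℝ => ‖(L * y : ℝ)‖ₑ := by fun_prop
      have := (this.tendsto 0).mono_left (nhdsWithin_le_nhds (s := Set.Ioi 0))
      simpa using this
    have := ENNReal.Tendsto.mul_const (b := eLpNorm f p volume) h3 (Or.inr hf.2.ne)
    rwa [zero_mul] at this
  have h3 := h1.add h2
  rw [add_zero] at h3
  refine tendsto_of_tendsto_of_tendsto_of_le_of_le' tendsto_const_nhds h3
    (Eventually.of_forall fun _ => zero_le) ?_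
  filter_upwards [self_mem_nhdsWithin, hA] with y hy hAy
  have hy : 0 < y := hy
  refine (eLpNorm_mono_real hAy).trans ?_
  refine (eLpNorm_add_le (f := fun x : ℝ => (c : ℝ) * ‖F ((x : ℂ) + (y : ℂ) * Complex.I) - f x‖)
    (g := fun x : ℝ => (L * y : ℝ) * ‖f x‖) ?_ ?_ hp).trans ?_
  · exact (((h.line_aesm hy).sub h.aesm).norm).const_mul _
  · exact h.aesm.norm.const_mul _
  · refine add_le_add ?_ ?_
    · refine (eLpNorm_const_smul_le (c := (c : ℝ))
        (f := fun x : ℝ => ‖F ((x : ℂ) + (y : ℂ) * Complex.I) - f x‖)).trans ?_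
      rw [eLpNorm_norm]
      simp
    · refine (eLpNorm_const_smul_le (c := (L * y : ℝ)) (f := fun x : ℝ => ‖f x‖)).trans ?_
      rw [eLpNorm_norm]

/-- On the line at height y, mF - mf = m(F - f) + (m(x + iy) - m(x)) f. The vertical Lipschitz bound
makes the second term O(y)|f|. -/
theorem mul_multiplier (h : IsHardyFun p f F) (hp : 1 ≤ p) {m : ℂ → ℂ} (hm : IsMultiplier m) :
    IsHardyFun p (fun x => m x * f x) (fun z => m z * F z) := by
  obtain ⟨C, hC⟩ := h.bounded
  obtain ⟨D, hD⟩ := hm.bounded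
  obtain ⟨L, hL⟩ := hm.lipschitz
  refine ⟨hm.cont.aestronglyMeasurable.mul h.aesm, hm.analytic.mul h.analytic,
    ⟨D * C, fun y hy => ?_⟩, h.tendsto_boundary_of_le hp (c := D) (L := L) ?_⟩
  · refine (eLpNorm_le_nnreal_smul_eLpNorm_of_ae_le_mul (c := D)
      (g := fun x : ℝ => F ((x : ℂ) + (y : ℂ) * Complex.I))
      (Eventually.of_forall fun x => ?_) p).trans ?_
    · rw [← NNReal.coe_le_coe]
      push_cast
      rw [norm_mul]
      gcongr
      exact hD _ (by simpa using hy.le)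
    · rw [ENNReal.smul_def, smul_eq_mul]
      push_cast
      exact mul_le_mul_right (hC y hy) _
  · filter_upwards [self_mem_nhdsWithin] with y hy x
    have hy : 0 < y := hy
    have e : m ((x : ℂ) + (y : ℂ) * Complex.I) * F ((x : ℂ) + (y : ℂ) * Complex.I) - m x * f x
      = m ((x : ℂ) + (y : ℂ) * Complex.I) * (F ((x : ℂ) + (y : ℂ) * Complex.I) - f x)
        + (m ((x : ℂ) + (y : ℂ) * Complex.I) - m x) * f x := by ring
    rw [e]
    refine (norm_add_le _ _).trans ?_
    rw [norm_mul, norm_mul]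
    gcongr
    · exact hD _ (by simpa using hy.le)
    · exact hL x y hy

theorem mul (hF : IsHardyFun 2 f F) (hG : IsHardyFun 2 g G) :
    IsHardyFun 1 (fun x => f x * g x) (fun z => F z * G z) := by
  have holder : ∀ {u v : ℝ → ℂ}, AEStronglyMeasurable u volume → AEStronglyMeasurable v volume →
      eLpNorm (fun x => u x * v x) 1 volume ≤ eLpNorm u 2 volume * eLpNorm v 2 volume := by
    intro u v hu hv
    have := eLpNorm_smul_le_mul_eLpNorm (p := 2) (q := 2) (r := 1) hv hu
    exact this
  obtain ⟨C, hC⟩ := hF.bounded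
  obtain ⟨D, hD⟩ := hG.bounded
  refine ⟨hF.aesm.mul hG.aesm, hF.analytic.mul hG.analytic, ⟨C * D, fun y hy => ?_⟩, ?_⟩
  · refine (holder (hF.line_aesm hy) (hG.line_aesm hy)).trans ?_
    push_cast
    exact mul_le_mul' (hC y hy) (hD y hy)
  · have h1 := ENNReal.Tendsto.mul_const (b := (D : ℝ≥0∞)) hF.boundary (Or.inr (by simp))
    have h2 := ENNReal.Tendsto.const_mul (a := eLpNorm f 2 volume) hG.boundary
      (Or.inr hF.memLp.2.ne)
    have h3 := h1.add h2
    rw [zero_mul, mul_zero, add_zero] at h3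
    refine tendsto_of_tendsto_of_tendsto_of_le_of_le' tendsto_const_nhds h3
      (Eventually.of_forall fun _ => zero_le) ?_
    filter_upwards [self_mem_nhdsWithin] with y hy
    have hy : 0 < y := hy
    have e : (fun x : ℝ => F ((x : ℂ) + (y : ℂ) * Complex.I) * G ((x : ℂ) + (y : ℂ) * Complex.I)
        - f x * g x) =
        (fun x : ℝ => (F ((x : ℂ) + (y : ℂ) * Complex.I) - f x) *
          G ((x : ℂ) + (y : ℂ) * Complex.I)) +
        fun x : ℝ => f x * (G ((x : ℂ) + (y : ℂ) * Complex.I) - g x) := by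
      funext x
      simp only [Pi.add_apply]
      ring
    rw [e]
    have mF := (hF.line_aesm hy).sub hF.aesm
    have mG := (hG.line_aesm hy).sub hG.aesm
    refine (eLpNorm_add_le (mF.mul (hG.line_aesm hy)) (hF.aesm.mul mG) le_rfl).trans ?_
    refine add_le_add ((holder mF (hG.line_aesm hy)).trans ?_) (holder hF.aesm mG)
    exact mul_le_mul' le_rfl (hD y hy)

/-- The reflection `z ↦ -conj z` of the upper half-plane acts on Hardy classes. -/
theorem reflect (h : IsHardyFun p f F) :
    IsHardyFun p (fun x => starRingEnd ℂ (f (-x)))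
      (fun z => starRingEnd ℂ (F (-starRingEnd ℂ z))) := by
  have hmp : MeasurePreserving (fun x : ℝ => -x) volume volume := Measure.measurePreserving_neg _
  have key : ∀ x y : ℝ, -starRingEnd ℂ ((x : ℂ) + (y : ℂ) * Complex.I) =
      ((-x : ℝ) : ℂ) + (y : ℂ) * Complex.I := by
    intro x y
    simp only [map_add, map_mul, Complex.conj_ofReal, Complex.conj_I]
    push_cast
    ring
  refine ⟨?_, ?_, ?_, ?_⟩
  · exact Complex.continuous_conj.comp_aestronglyMeasurable (h.aesm.comp_measurePreserving hmp)
  · intro z hz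
    have hz' : 0 < (-starRingEnd ℂ z).im := by simpa using hz
    have hd : DifferentiableAt ℂ F (-starRingEnd ℂ z) :=
      h.analytic.differentiableAt (isOpen_upperHalf.mem_nhds hz')
    have h1 : DifferentiableAt ℂ (fun u => F (-u)) (starRingEnd ℂ z) :=
      DifferentiableAt.comp (g := F) (f := fun u : ℂ => -u) _ hd differentiableAt_id.neg
    have h2 := h1.conj_conj
    rw [Complex.conj_conj] at h2
    exact h2.differentiableWithinAt
  · obtain ⟨C, hC⟩ := h.bounded
    refine ⟨C, fun y hy => le_trans (le_of_eq ?_) (hC y hy)⟩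
    rw [← eLpNorm_comp_measurePreserving (h.line_aesm hy) hmp]
    refine eLpNorm_congr_norm_ae (Eventually.of_forall fun x => ?_)
    simp only [key, RCLike.norm_conj, Function.comp_apply]
  · refine h.boundary.congr' ?_
    filter_upwards [self_mem_nhdsWithin] with y hy
    refine (eLpNorm_comp_measurePreserving ((h.line_aesm hy).sub h.aesm) hmp).symm.trans ?_
    refine eLpNorm_congr_norm_ae (Eventually.of_forall fun x => ?_)
    simp only [key, Function.comp_apply, ← map_sub, RCLike.norm_conj, Pi.sub_apply]

end IsHardyFun

/-! ### The algebra of multipliers. -/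

namespace IsMultiplier

theorem const (c : ℂ) : IsMultiplier fun _ => c :=
  ⟨differentiableOn_const c, continuous_const, ⟨‖c‖₊, fun _ _ => by simp⟩,
    ⟨0, fun _ _ _ => by simp⟩⟩

theorem add {m n : ℂ → ℂ} (hm : IsMultiplier m) (hn : IsMultiplier n) :
    IsMultiplier fun z => m z + n z := by
  obtain ⟨C, hC⟩ := hm.bounded
  obtain ⟨D, hD⟩ := hn.bounded
  obtain ⟨L, hL⟩ := hm.lipschitz
  obtain ⟨N, hN⟩ := hn.lipschitz
  refine ⟨hm.analytic.add hn.analytic, hm.cont.add hn.cont, ⟨C + D, fun z hz => ?_⟩,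
    ⟨L + N, fun x y hy => ?_⟩⟩
  · push_cast
    exact (norm_add_le _ _).trans (add_le_add (hC z hz) (hD z hz))
  · push_cast
    rw [add_sub_add_comm, add_mul]
    exact (norm_add_le _ _).trans (add_le_add (hL x y hy) (hN x y hy))

theorem mul {m n : ℂ → ℂ} (hm : IsMultiplier m) (hn : IsMultiplier n) :
    IsMultiplier fun z => m z * n z := by
  obtain ⟨C, hC⟩ := hm.bounded
  obtain ⟨D, hD⟩ := hn.bounded
  obtain ⟨L, hL⟩ := hm.lipschitz
  obtain ⟨N, hN⟩ := hn.lipschitz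
  refine ⟨hm.analytic.mul hn.analytic, hm.cont.mul hn.cont, ⟨C * D, fun z hz => ?_⟩,
    ⟨C * N + L * D, fun x y hy => ?_⟩⟩
  · push_cast
    rw [norm_mul]
    gcongr
    exacts [hC z hz, hD z hz]
  · have e : m ((x : ℂ) + (y : ℂ) * Complex.I) * n ((x : ℂ) + (y : ℂ) * Complex.I) - m x * n x
      = m ((x : ℂ) + (y : ℂ) * Complex.I) * (n ((x : ℂ) + (y : ℂ) * Complex.I) - n x)
        + (m ((x : ℂ) + (y : ℂ) * Complex.I) - m x) * n x := by ring
    rw [e]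
    refine (norm_add_le _ _).trans ?_
    rw [norm_mul, norm_mul]
    push_cast
    have h1 := hC ((x : ℂ) + (y : ℂ) * Complex.I) (by simpa using hy.le)
    have h2 := hD x (by simp)
    calc _ ≤ (C : ℝ) * (N * y) + (L * y) * D := by
          gcongr
          exacts [hN x y hy, hL x y hy]
      _ = _ := by ring

theorem pow {m : ℂ → ℂ} (hm : IsMultiplier m) (k : ℕ) : IsMultiplier fun z => m z ^ k := by
  induction k with
  | zero => simpa using const 1
  | succ k ih => simpa only [pow_succ] using ih.mul hm

theorem prod {ι : Type*} (s : Finset ι) {m : ι → ℂ → ℂ} (hm : ∀ i ∈ s, IsMultiplier (m i)) :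
    IsMultiplier fun z => ∏ i ∈ s, m i z := by
  classical
  induction s using Finset.induction_on with
  | empty => simpa using const 1
  | insert i s hi ih =>
    simp only [Finset.prod_insert hi]
    exact (hm i (by simp)).mul (ih fun j hj => hm j (by simp [hj]))

theorem sum {ι : Type*} (s : Finset ι) {m : ι → ℂ → ℂ} (hm : ∀ i ∈ s, IsMultiplier (m i)) :
    IsMultiplier fun z => ∑ i ∈ s, m i z := by
  classical
  induction s using Finset.induction_on with
  | empty => simpa using const 0
  | insert i s hi ih =>
    simp only [Finset.sum_insert hi]
    exact (hm i (by simp)).add (ih fun j hj => hm j (by simp [hj]))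

end IsMultiplier

theorem abs_im_le_norm_sub {β : ℂ} (z : ℂ) : |z.im - β.im| ≤ ‖z - β‖ := by
  simpa using Complex.abs_im_le_norm (z - β)

theorem sub_ne_zero_of_im_lt {β z : ℂ} (h : β.im < z.im) : z - β ≠ 0 := by
  intro h0
  rw [sub_eq_zero] at h0
  simp [h0] at h

/-- The pole lies at distance at least -Im β from the closed upper half-plane, which bounds the
function; the resolvent identity gives the square of that bound as Lipschitz constant. -/
theorem isMultiplier_inv_sub {β : ℂ} (hβ : β.im < 0) : IsMultiplier fun z => (z - β)⁻¹ := by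
  have hb : ∀ z : ℂ, 0 ≤ z.im → ‖(z - β)⁻¹‖ ≤ (-β.im)⁻¹ := by
    intro z hz
    rw [norm_inv]
    refine inv_anti₀ (by linarith) ?_
    exact le_trans (by linarith [le_abs_self (z.im - β.im)]) (abs_im_le_norm_sub z)
  have hpos : 0 ≤ (-β.im)⁻¹ := by
    rw [inv_nonneg]; linarith
  have hne : ∀ z : ℂ, 0 ≤ z.im → z - β ≠ 0 := fun z hz =>
    sub_ne_zero_of_im_lt (hβ.trans_le hz)
  refine ⟨?_, ?_, ⟨⟨_, hpos⟩, hb⟩, ⟨⟨_, hpos⟩ * ⟨_, hpos⟩, ?_⟩⟩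
  · intro z hz
    have hz : 0 < z.im := hz
    have := hne z hz.le
    fun_prop (disch := assumption)
  · refine Continuous.inv₀ (by fun_prop) fun x => hne x (by simp)
  · intro x y hy
    have h1 := hne ((x : ℂ) + (y : ℂ) * Complex.I) (by simpa using hy.le)
    have h2 := hne x (by simp)
    have e : ((x : ℂ) + (y : ℂ) * Complex.I - β)⁻¹ - ((x : ℂ) - β)⁻¹ =
        ((x : ℂ) + (y : ℂ) * Complex.I - β)⁻¹ * ((x : ℂ) - β)⁻¹ * (-(y * Complex.I)) := by
      field_simp
      ring
    rw [e, norm_mul, norm_mul]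
    have h3 : ‖-((y : ℂ) * Complex.I)‖ = y := by simp [abs_of_pos hy]
    rw [h3]
    have h4 := hb ((x : ℂ) + (y : ℂ) * Complex.I) (by simpa using hy.le)
    have h5 := hb x (by simp)
    show _ ≤ ((-β.im)⁻¹ * (-β.im)⁻¹) * y
    gcongr

/-! ### Cauchy's theorem in H¹ and division by zeros. -/

/-- Cauchy's theorem for two horizontal lines. -/
theorem integral_line_eq {F : ℂ → ℂ} (hF : DifferentiableOn ℂ F {z : ℂ | 0 < z.im}) {C : ℝ≥0}
    (hC : ∀ y : ℝ, 0 < y →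
      eLpNorm (fun x : ℝ => F ((x : ℂ) + (y : ℂ) * Complex.I)) 1 volume ≤ C)
    {y₁ y₂ : ℝ} (hy₁ : 0 < y₁) (hy : y₁ ≤ y₂) :
    ∫ x : ℝ, F ((x : ℂ) + (y₁ : ℂ) * Complex.I) = ∫ x : ℝ, F ((x : ℂ) + (y₂ : ℂ) * Complex.I) := by
  have hint : ∀ y : ℝ, 0 < y → Integrable (fun x : ℝ => F ((x : ℂ) + (y : ℂ) * Complex.I)) :=
    fun y hy => memLp_one_iff_integrable.1
      ⟨aestronglyMeasurable_line hF hy, (hC y hy).trans_lt ENNReal.coe_lt_top⟩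
  set μ := (volume : Measure ℝ).restrict (Set.Ioc y₁ y₂) with hμ
  have haesm : AEStronglyMeasurable (fun q : ℝ × ℝ => F ((q.1 : ℂ) + (q.2 : ℂ) * Complex.I))
      (volume.prod μ) := by
    have hc : ContinuousOn (fun q : ℝ × ℝ => F ((q.1 : ℂ) + (q.2 : ℂ) * Complex.I))
        (Set.univ ×ˢ Set.Ioc y₁ y₂) := by
      refine hF.continuousOn.comp (by fun_prop) ?_
      rintro ⟨x, y⟩ ⟨-, h⟩
      simpa using hy₁.trans h.1
    have := hc.aestronglyMeasurable (μ := (volume : Measure ℝ).prod volume)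
      (MeasurableSet.univ.prod measurableSet_Ioc)
    rwa [← Measure.prod_restrict, Measure.restrict_univ] at this
  have hprod : Integrable (fun q : ℝ × ℝ => F ((q.1 : ℂ) + (q.2 : ℂ) * Complex.I))
      (volume.prod μ) := by
    rw [integrable_prod_iff' haesm]
    constructor
    · filter_upwards [ae_restrict_mem measurableSet_Ioc] with y hy
      exact hint y (hy₁.trans hy.1)
    · refine Integrable.mono' (g := fun _ => (C : ℝ)) (by simp [hμ]) ?_ ?_
      · exact (haesm.norm.prod_swap).integral_prod_right'
      · filter_upwards [ae_restrict_mem measurableSet_Ioc] with y hy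
        have hy' := hy₁.trans hy.1
        rw [Real.norm_of_nonneg (integral_nonneg fun _ => norm_nonneg _),
          integral_norm_eq_lintegral_enorm (hint y hy').1]
        have := hC y hy'
        rw [eLpNorm_one_eq_lintegral_enorm] at this
        simpa using ENNReal.toReal_mono (by simp) this
  -- By Fubini the integrals over the vertical segments form an integrable function of the abscissa,
  -- so the two sides of the rectangle are small for arbitrarily large R. This frequent smallness
  -- suffices because the horizontal integrals converge.
  have hk : Integrable fun x : ℝ => ∫ y, ‖F ((x : ℂ) + (y : ℂ) * Complex.I)‖ ∂μ :=
    hprod.integral_norm_prod_left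
  set k : ℝ → ℝ := fun x => ∫ y, ‖F ((x : ℂ) + (y : ℂ) * Complex.I)‖ ∂μ with hkdef
  have hk2 : Integrable fun x => k x + k (-x) := hk.add hk.comp_neg
  have hfreq : ∀ ε > 0, ∃ᶠ R in atTop, k R + k (-R) < ε := by
    intro ε hε hcon
    obtain ⟨R₀, hR₀⟩ := eventually_atTop.1 hcon
    have : IntegrableOn (fun _ : ℝ => ε) (Set.Ioi R₀) := by
      refine Integrable.mono' hk2.integrableOn aestronglyMeasurable_const ?_
      filter_upwards [ae_restrict_mem measurableSet_Ioi] with x hx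
      rw [Real.norm_of_nonneg hε.le]
      exact not_lt.1 (hR₀ x (le_of_lt hx))
    rw [integrableOn_const_iff] at this
    simp [hε.ne'] at this
  have hlim : ∀ y : ℝ, 0 < y → Tendsto
      (fun R : ℝ => ∫ x in (-R)..R, F ((x : ℂ) + (y : ℂ) * Complex.I)) atTop
      (𝓝 (∫ x : ℝ, F ((x : ℂ) + (y : ℂ) * Complex.I))) := fun y hy =>
    intervalIntegral_tendsto_integral (hint y hy) tendsto_neg_atTop_atBot tendsto_id
  have hD := (hlim y₁ hy₁).sub (hlim y₂ (hy₁.trans_le hy))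
  have hside : ∀ R : ℝ, ‖∫ y in y₁..y₂, F ((R : ℂ) + (y : ℂ) * Complex.I)‖ ≤ k R := by
    intro R
    refine (intervalIntegral.norm_integral_le_integral_norm hy).trans (le_of_eq ?_)
    rw [intervalIntegral.integral_of_le hy]
  have hbd : ∀ R : ℝ, ‖(∫ x in (-R)..R, F ((x : ℂ) + (y₁ : ℂ) * Complex.I)) -
      ∫ x in (-R)..R, F ((x : ℂ) + (y₂ : ℂ) * Complex.I)‖ ≤ k R + k (-R) := by
    intro R
    have hrect := Complex.integral_boundary_rect_eq_zero_of_differentiableOn F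
      ((-R : ℝ) + y₁ * Complex.I) ((R : ℝ) + y₂ * Complex.I) (hF.mono ?_)
    · simp only [Complex.add_re, Complex.ofReal_re, Complex.mul_re, Complex.I_re, mul_zero,
        Complex.ofReal_im, Complex.I_im, mul_one, sub_self, add_zero, Complex.add_im,
        Complex.mul_im, zero_add, smul_eq_mul] at hrect
      have e : (∫ x in (-R)..R, F ((x : ℂ) + (y₁ : ℂ) * Complex.I)) -
          (∫ x in (-R)..R, F ((x : ℂ) + (y₂ : ℂ) * Complex.I)) =
          Complex.I * (∫ y in y₁..y₂, F (((-R : ℝ) : ℂ) + (y : ℂ) * Complex.I)) -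
          Complex.I * (∫ y in y₁..y₂, F ((R : ℂ) + (y : ℂ) * Complex.I)) := by
        linear_combination hrect
      rw [e]
      refine (norm_sub_le _ _).trans ?_
      rw [norm_mul, norm_mul, Complex.norm_I, one_mul, one_mul, add_comm]
      exact add_le_add (hside R) (hside (-R))
    · intro z hz
      have := hz.2
      simp only [Complex.add_im, Complex.ofReal_im, Complex.mul_im, Complex.ofReal_re,
        Complex.I_im, mul_one, Complex.I_re, mul_zero, add_zero, zero_add,
        Set.uIcc_of_le hy] at this
      exact hy₁.trans_le this.1
  rw [← sub_eq_zero, ← norm_le_zero_iff]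
  refine le_of_forall_pos_lt_add fun ε hε => ?_
  rw [zero_add]
  by_contra! hcon
  have h1 := hD.norm.eventually_const_lt (u := ε / 2) (by linarith)
  obtain ⟨R, hR1, hR2⟩ := ((hfreq (ε / 2) (by linarith)).and_eventually h1).exists
  linarith [hbd R]

namespace IsHardyFun

variable {p : ℝ≥0∞} {f g : ℝ → ℂ} {F G : ℂ → ℂ}

theorem tendsto_integral (h : IsHardyFun 1 f F) :
    Tendsto (fun y : ℝ => ∫ x : ℝ, F ((x : ℂ) + (y : ℂ) * Complex.I)) (𝓝[>] 0)
      (𝓝 (∫ x, f x)) := by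
  refine tendsto_integral_of_L1' f h.aesm ?_ h.boundary
  filter_upwards [self_mem_nhdsWithin] with y hy
  exact memLp_one_iff_integrable.1 (h.line_memLp hy)

theorem integral_line_eq_integral (h : IsHardyFun 1 f F) {y : ℝ} (hy : 0 < y) :
    ∫ x : ℝ, F ((x : ℂ) + (y : ℂ) * Complex.I) = ∫ x, f x := by
  obtain ⟨C, hC⟩ := h.bounded
  refine tendsto_nhds_unique (tendsto_const_nhds.congr' ?_) h.tendsto_integral
  filter_upwards [Ioo_mem_nhdsGT hy] with t ht
  exact (integral_line_eq h.analytic hC ht.1 ht.2.le).symm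

/-- Cauchy's theorem for the Hardy class `H¹`. -/
theorem integral_eq_zero (h : IsHardyFun 1 f F) : ∫ x, f x = 0 := by
  have hI : ∀ n : ℕ, (-((n : ℂ) + 1) * Complex.I).im < 0 := by
    intro n
    simp only [Complex.mul_im, Complex.neg_re, Complex.add_re, Complex.natCast_re, Complex.one_re,
      Complex.I_im, Complex.I_re]
    have : (0 : ℝ) ≤ n := n.cast_nonneg
    linarith
  have hf := memLp_one_iff_integrable.1 h.memLp
  -- The factor (n+1)i / (z + (n+1)i) decays like 1/y on high lines, while the integral does not
  -- depend on the line; hence it vanishes. As n → ∞ the factor tends to 1 and stays bounded by 1 on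
  -- ℝ, so it can be removed by dominated convergence.
  have step : ∀ n : ℕ,
      ∫ x : ℝ, ((n : ℂ) + 1) * Complex.I * ((x : ℂ) - (-((n : ℂ) + 1) * Complex.I))⁻¹ * f x
        = 0 := by
    intro n
    have hm := (IsMultiplier.const (((n : ℂ) + 1) * Complex.I)).mul (isMultiplier_inv_sub (hI n))
    have hh := h.mul_multiplier le_rfl hm
    obtain ⟨C, hC⟩ := h.bounded
    have hbd : ∀ y : ℝ, 0 < y → ‖∫ x : ℝ, ((n : ℂ) + 1) * Complex.I *
        ((x : ℂ) - (-((n : ℂ) + 1) * Complex.I))⁻¹ * f x‖ ≤ (n + 1) * C * y⁻¹ := by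
      intro y hy
      rw [← hh.integral_line_eq_integral hy]
      have hi := memLp_one_iff_integrable.1 (h.line_memLp hy)
      refine (norm_integral_le_of_norm_le (hi.norm.const_mul ((n + 1) * y⁻¹))
        (Eventually.of_forall fun x => ?_)).trans ?_
      · rw [norm_mul, norm_mul, norm_mul, Complex.norm_I, mul_one, norm_inv]
        have h1 : ‖(n : ℂ) + 1‖ = n + 1 := by exact_mod_cast Complex.norm_natCast (n + 1)
        rw [h1]
        gcongr
        refine le_trans ?_ (abs_im_le_norm_sub _)
        refine le_trans ?_ (le_abs_self _)
        have := hI n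
        rw [line_im]
        linarith
      · rw [integral_const_mul, integral_norm_eq_lintegral_enorm hi.1]
        have := hC y hy
        rw [eLpNorm_one_eq_lintegral_enorm] at this
        have := ENNReal.toReal_mono (by simp) this
        rw [ENNReal.coe_toReal] at this
        calc _ ≤ ((n : ℝ) + 1) * y⁻¹ * C := by gcongr
          _ = _ := by ring
    rw [← norm_le_zero_iff]
    refine ge_of_tendsto (f := fun y : ℝ => ((n : ℝ) + 1) * C * y⁻¹) (x := atTop) ?_ ?_
    · simpa using tendsto_inv_atTop_zero.const_mul (((n : ℝ) + 1) * C)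
    · filter_upwards [eventually_gt_atTop 0] with y hy using hbd y hy
  have hlim : Tendsto (fun n : ℕ => ∫ x : ℝ, ((n : ℂ) + 1) * Complex.I *
      ((x : ℂ) - (-((n : ℂ) + 1) * Complex.I))⁻¹ * f x) atTop (𝓝 (∫ x, f x)) := by
    refine tendsto_integral_of_dominated_convergence (fun x => ‖f x‖) ?_ hf.norm ?_ ?_
    · intro n
      have hm := (IsMultiplier.const (((n : ℂ) + 1) * Complex.I)).mul (isMultiplier_inv_sub (hI n))
      exact (h.mul_multiplier le_rfl hm).aesm
    · intro n
      refine Eventually.of_forall fun x => ?_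
      rw [norm_mul]
      refine mul_le_of_le_one_left (norm_nonneg _) ?_
      have h1 : ‖((n : ℂ) + 1) * Complex.I‖ = n + 1 := by
        rw [norm_mul, Complex.norm_I, mul_one]
        exact_mod_cast Complex.norm_natCast (n + 1)
      rw [norm_mul, norm_inv, h1]
      refine mul_inv_le_one_of_le₀ ?_ (norm_nonneg _)
      refine le_trans ?_ (abs_im_le_norm_sub _)
      refine le_trans (le_of_eq ?_) (le_abs_self _)
      simp
    · refine Eventually.of_forall fun x => ?_
      have h1 : Tendsto (fun n : ℕ => (1 + (x : ℂ) * (((n : ℂ) + 1)⁻¹ * Complex.I⁻¹))⁻¹ * f x)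
          atTop (𝓝 ((1 + (x : ℂ) * (0 * Complex.I⁻¹))⁻¹ * f x)) := by
        have h0 : Tendsto (fun n : ℕ => ((n : ℂ) + 1)⁻¹) atTop (𝓝 0) := by
          simpa using tendsto_one_div_add_atTop_nhds_zero_nat (𝕜 := ℂ)
        refine Tendsto.mul_const _ (Tendsto.inv₀ ?_ (by simp))
        exact ((h0.mul_const _).const_mul _).const_add _
      simp only [zero_mul, mul_zero, add_zero, inv_one, one_mul] at h1
      refine h1.congr fun n => ?_
      congr 1
      have hn : (n : ℂ) + 1 ≠ 0 := by exact_mod_cast n.succ_ne_zero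
      have hne := sub_ne_zero_of_im_lt (β := -((n : ℂ) + 1) * Complex.I) (z := x)
        (by simpa using hI n)
      have hI0 := Complex.I_ne_zero
      have e : 1 + (x : ℂ) * (((n : ℂ) + 1)⁻¹ * Complex.I⁻¹) =
          (((n : ℂ) + 1) * Complex.I)⁻¹ * ((x : ℂ) - (-((n : ℂ) + 1) * Complex.I)) := by
        field_simp
        ring
      rw [e, mul_inv, inv_inv]
  exact tendsto_nhds_unique hlim (by simp only [step]; exact tendsto_const_nhds)

/-- Dividing out a zero in the upper half-plane stays in the Hardy class. -/
theorem div_sub (h : IsHardyFun p f F) (hp : 1 ≤ p) {a : ℂ} (ha : 0 < a.im) (hFa : F a = 0) :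
    IsHardyFun p (fun x => f x / (x - a)) (dslope F a) := by
  have hmem : {z : ℂ | 0 < z.im} ∈ 𝓝 a := isOpen_upperHalf.mem_nhds ha
  have hd : DifferentiableOn ℂ (dslope F a) {z : ℂ | 0 < z.im} :=
    (Complex.differentiableOn_dslope hmem).2 h.analytic
  have hval : ∀ z, z ≠ a → dslope F a z = F z / (z - a) := by
    intro z hz
    rw [dslope_of_ne _ hz, slope_def_field, hFa, sub_zero]
  have hne : ∀ x : ℝ, (x : ℂ) - a ≠ 0 := fun x h0 => by
    rw [sub_eq_zero] at h0
    simp [← h0] at ha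
  have hxa : ∀ x : ℝ, a.im ≤ ‖(x : ℂ) - a‖ := fun x =>
    le_trans (by simp [le_abs_self]) (abs_im_le_norm_sub (x : ℂ))
  refine ⟨?_, hd, ?_, ?_⟩
  · exact h.aesm.div₀ (by fun_prop) |>.congr (Eventually.of_forall fun _ => rfl)
  -- On the compact rectangle S around a, which stays inside the half-plane, the quotient is bounded
  -- by continuity. Off S, |z - a| is at least (2/Im a + 1)⁻¹, a number below both half-widths 1 and
  -- Im a / 2.
  · set S : Set ℂ := Set.Icc (a.re - 1) (a.re + 1) ×ℂ Set.Icc (a.im / 2) (3 * a.im / 2) with hS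
    have hSc : IsCompact S := isCompact_Icc.reProdIm isCompact_Icc
    obtain ⟨B, hB⟩ := hSc.exists_bound_of_continuousOn (f := dslope F a)
      (hd.continuousOn.mono fun z hz => lt_of_lt_of_le (by linarith) hz.2.1)
    have hpt : ∀ y : ℝ, 0 < y → ∀ x : ℝ, ‖dslope F a ((x : ℂ) + (y : ℂ) * Complex.I)‖ ≤
        (2 / a.im + 1) * ‖F ((x : ℂ) + (y : ℂ) * Complex.I)‖ +
          (Set.Icc (a.re - 1) (a.re + 1)).indicator (fun _ => |B|) x := by
      intro y hy x
      have hind : 0 ≤ (Set.Icc (a.re - 1) (a.re + 1)).indicator (fun _ => |B|) x :=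
        Set.indicator_nonneg (fun _ _ => abs_nonneg _) _
      set z := (x : ℂ) + (y : ℂ) * Complex.I with hz
      have hzre : z.re = x := by simp [hz]
      have hzim : z.im = y := by simp [hz]
      by_cases hzS : z ∈ S
      · have hx : x ∈ Set.Icc (a.re - 1) (a.re + 1) := hzre ▸ hzS.1
        rw [Set.indicator_of_mem hx]
        have := (hB z hzS).trans (le_abs_self B)
        have : 0 ≤ (2 / a.im + 1) * ‖F z‖ := by positivity
        linarith
      · have hdist : (2 / a.im + 1)⁻¹ ≤ ‖z - a‖ := by
          by_contra! hcon
          refine hzS ?_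
          have h1 := (Complex.abs_re_le_norm (z - a)).trans_lt hcon
          have h2 := (Complex.abs_im_le_norm (z - a)).trans_lt hcon
          have h3 : (2 / a.im + 1)⁻¹ ≤ 1 := inv_le_one_of_one_le₀ (by
            have : 0 < 2 / a.im := by positivity
            linarith)
          have h4 : (2 / a.im + 1)⁻¹ ≤ a.im / 2 := by
            rw [inv_le_comm₀ (by positivity) (by positivity), inv_div]
            linarith
          rw [Complex.sub_re, abs_lt] at h1
          rw [Complex.sub_im, abs_lt] at h2
          exact ⟨⟨by linarith, by linarith⟩, ⟨by linarith, by linarith⟩⟩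
        have hza : z ≠ a := by
          rintro rfl
          simp only [sub_self, norm_zero] at hdist
          have : 0 < (2 / z.im + 1)⁻¹ := by positivity
          linarith
        rw [hval z hza, norm_div, div_eq_inv_mul]
        have : ‖z - a‖⁻¹ ≤ 2 / a.im + 1 := by
          rw [inv_le_comm₀ (norm_pos_iff.2 (sub_ne_zero.2 hza)) (by positivity)]
          exact hdist
        have : ‖z - a‖⁻¹ * ‖F z‖ ≤ (2 / a.im + 1) * ‖F z‖ := by gcongr
        linarith
    obtain ⟨C, hC⟩ := h.bounded
    have hI : MemLp ((Set.Icc (a.re - 1) (a.re + 1)).indicator fun _ : ℝ => |B|) p volume :=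
      memLp_indicator_const p measurableSet_Icc _ (Or.inr (by simp))
    refine ⟨(2 / a.im.toNNReal + 1) * C + (eLpNorm ((Set.Icc (a.re - 1) (a.re + 1)).indicator
      fun _ : ℝ => |B|) p volume).toNNReal, fun y hy => ?_⟩
    refine (eLpNorm_mono_real (hpt y hy)).trans ?_
    refine (eLpNorm_add_le (f := fun x : ℝ => (2 / a.im + 1) *
      ‖F ((x : ℂ) + (y : ℂ) * Complex.I)‖) ((h.line_aesm hy).norm.const_mul _) hI.1 hp).trans ?_
    rw [ENNReal.coe_add, ENNReal.coe_toNNReal hI.2.ne]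
    refine add_le_add ?_ le_rfl
    refine (eLpNorm_const_smul_le (c := (2 / a.im + 1 : ℝ))
        (f := fun x : ℝ => ‖F ((x : ℂ) + (y : ℂ) * Complex.I)‖)).trans ?_
    rw [eLpNorm_norm, ENNReal.coe_mul]
    refine mul_le_mul' (le_of_eq ?_) (hC y hy)
    rw [Real.enorm_of_nonneg (by positivity), ENNReal.ofReal]
    congr 1
    rw [← NNReal.coe_inj]
    push_cast
    rw [Real.coe_toNNReal _ (by positivity), Real.coe_toNNReal _ ha.le]
  · have hb : 0 ≤ 2 / a.im := by positivity
    refine h.tendsto_boundary_of_le hp (c := ⟨2 / a.im, hb⟩) (L := ⟨2 / a.im ^ 2, by positivity⟩) ?_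
    -- Only heights below Im a / 2 matter in the limit, and these lines stay at distance at least Im
    -- a / 2 from a.
    filter_upwards [Ioo_mem_nhdsGT (half_pos ha)] with y hy x
    have hza : a.im / 2 ≤ ‖(x : ℂ) + (y : ℂ) * Complex.I - a‖ := by
      refine le_trans ?_ (abs_im_le_norm_sub _)
      rw [line_im, abs_sub_comm]
      exact le_trans (by linarith [hy.2]) (le_abs_self _)
    have hz0 : (x : ℂ) + (y : ℂ) * Complex.I - a ≠ 0 := by
      intro h0
      rw [h0, norm_zero] at hza
      linarith
    rw [hval _ (sub_ne_zero.1 hz0)]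
    have hx0 := hne x
    have e : F ((x : ℂ) + (y : ℂ) * Complex.I) / ((x : ℂ) + (y : ℂ) * Complex.I - a) -
        f x / (x - a) = ((x : ℂ) + (y : ℂ) * Complex.I - a)⁻¹ *
          (F ((x : ℂ) + (y : ℂ) * Complex.I) - f x) +
          ((x : ℂ) + (y : ℂ) * Complex.I - a)⁻¹ * ((x : ℂ) - a)⁻¹ * (-(y * Complex.I)) * f x := by
      field_simp
      ring
    rw [e]
    refine (norm_add_le _ _).trans ?_
    have i1 : ‖((x : ℂ) + (y : ℂ) * Complex.I - a)⁻¹‖ ≤ 2 / a.im := by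
      rw [norm_inv, ← inv_div]
      exact inv_anti₀ (by positivity) hza
    have i2 : ‖((x : ℂ) - a)⁻¹‖ ≤ 1 / a.im := by
      rw [norm_inv, one_div]
      exact inv_anti₀ ha (hxa x)
    have i3 : ‖-((y : ℂ) * Complex.I)‖ = y := by simp [abs_of_pos hy.1]
    rw [norm_mul, norm_mul, norm_mul, norm_mul, i3]
    have i4 : (2 / a.im) * (1 / a.im) = 2 / a.im ^ 2 := by
      field_simp
    have hy0 := hy.1.le
    refine add_le_add (mul_le_mul_of_nonneg_right i1 (norm_nonneg _)) ?_
    show _ ≤ 2 / a.im ^ 2 * y * ‖f x‖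
    rw [← i4]
    gcongr

end IsHardyFun

/-! ### Möbius factors and a zero-free Hardy function. -/

theorem IsMultiplier.congr {m n : ℂ → ℂ} (hm : IsMultiplier m) (h : ∀ z : ℂ, 0 ≤ z.im → n z = m z) :
    IsMultiplier n := by
  obtain ⟨C, hC⟩ := hm.bounded
  obtain ⟨L, hL⟩ := hm.lipschitz
  refine ⟨hm.analytic.congr fun z hz => h z (le_of_lt hz), ?_, ⟨C, fun z hz => ?_⟩,
    ⟨L, fun x y hy => ?_⟩⟩
  · convert hm.cont using 2 with x
    exact h x (by simp)
  · rw [h z hz]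
    exact hC z hz
  · rw [h x (by simp), h _ (by simpa using hy.le)]
    exact hL x y hy

theorem add_I_ne_zero {z : ℂ} (hz : 0 ≤ z.im) : z + Complex.I ≠ 0 := by
  intro h0
  have := congrArg Complex.im h0
  simp only [Complex.add_im, Complex.I_im, Complex.zero_im] at this
  linarith

theorem real_sub_ne_zero {a : ℂ} (ha : 0 < a.im) (x : ℝ) : (x : ℂ) - a ≠ 0 := fun h0 => by
  rw [sub_eq_zero] at h0
  simp [← h0] at ha

theorem isMultiplier_inv_add_I : IsMultiplier fun z => (z + Complex.I)⁻¹ := by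
  simpa using isMultiplier_inv_sub (β := -Complex.I) (by simp)

/-- The fractional linear function with a simple zero at `a` and a simple pole at `-i`. -/
noncomputable def mobius (a z : ℂ) : ℂ := (z - a) / (z + Complex.I)

theorem isMultiplier_mobius (a : ℂ) : IsMultiplier (mobius a) := by
  refine ((IsMultiplier.const 1).add
    ((IsMultiplier.const (-(a + Complex.I))).mul isMultiplier_inv_add_I)).congr fun z hz => ?_
  have := add_I_ne_zero hz
  rw [mobius]
  field_simp
  ring

theorem mobius_ne_zero {a z : ℂ} (hz : 0 ≤ z.im) (h : z ≠ a) : mobius a z ≠ 0 :=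
  div_ne_zero (sub_ne_zero.2 h) (add_I_ne_zero hz)

theorem mobius_real_ne_zero {a : ℂ} (ha : 0 < a.im) (x : ℝ) : mobius a x ≠ 0 :=
  div_ne_zero (real_sub_ne_zero ha x) (add_I_ne_zero (by simp))

theorem mobius_reflect (a z : ℂ) :
    starRingEnd ℂ (mobius a (-starRingEnd ℂ z)) = mobius (-starRingEnd ℂ a) z := by
  simp only [mobius, map_div₀, map_sub, map_add, map_neg, Complex.conj_conj, Complex.conj_I]
  rw [← neg_div_neg_eq]
  congr 1 <;> ring

/-- Each monomial z^j with j ≤ K splits as (z/(z+i))^j (z+i)^{-(K-j)}. The argument -z appears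
because the form integrates φ(-x). -/
theorem isMultiplier_polynomial_div {Q : ℂ[X]} {K : ℕ} (hQ : Q.natDegree ≤ K) :
    IsMultiplier fun z => Q.eval (-z) / (z + Complex.I) ^ K := by
  refine (IsMultiplier.sum (Finset.range (K + 1)) fun j _ =>
    ((IsMultiplier.const (Q.coeff j * (-1) ^ j)).mul ((isMultiplier_mobius 0).pow j)).mul
      (isMultiplier_inv_add_I.pow (K - j))).congr fun z hz => ?_
  have h0 := add_I_ne_zero hz
  rw [Polynomial.eval_eq_sum_range' (Nat.lt_succ_of_le hQ), Finset.sum_div]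
  refine Finset.sum_congr rfl fun j hj => ?_
  have hj : j ≤ K := Nat.lt_succ_iff.1 (Finset.mem_range.1 hj)
  obtain ⟨d, rfl⟩ := Nat.exists_eq_add_of_le hj
  rw [mobius, sub_zero, Nat.add_sub_cancel_left, div_pow, inv_pow, pow_add, neg_pow]
  field_simp

/-- Moving up only increases |x + iy + i|, so the norm on ℝ dominates the norms on all lines, and
the difference from the boundary value is at most y times the function itself. -/
theorem isHardyFun_inv_add_I :
    IsHardyFun 2 (fun x : ℝ => ((x : ℂ) + Complex.I)⁻¹) (fun z => (z + Complex.I)⁻¹) := by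
  have hm := isMultiplier_inv_add_I
  have hL : MemLp (fun x : ℝ => ((x : ℂ) + Complex.I)⁻¹) 2 volume := by
    rw [memLp_two_iff_integrable_sq_norm hm.cont.aestronglyMeasurable]
    refine integrable_inv_one_add_sq.congr (Eventually.of_forall fun x => ?_)
    simp only [norm_inv, inv_pow, Complex.sq_norm, Complex.normSq_apply]
    simp only [Complex.add_re, Complex.ofReal_re, Complex.I_re, add_zero, Complex.add_im,
      Complex.ofReal_im, Complex.I_im, zero_add, mul_one]
    ring_nf
  refine ⟨hm.cont.aestronglyMeasurable, hm.analytic, ?_, ?_⟩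
  · refine ⟨(eLpNorm (fun x : ℝ => ((x : ℂ) + Complex.I)⁻¹) 2 volume).toNNReal, fun y hy => ?_⟩
    rw [ENNReal.coe_toNNReal hL.2.ne]
    refine eLpNorm_mono fun x => ?_
    rw [norm_inv, norm_inv]
    refine inv_anti₀ (norm_pos_iff.2 (add_I_ne_zero (by simp))) ?_
    refine le_of_sq_le_sq ?_ (norm_nonneg _)
    simp only [Complex.sq_norm, Complex.normSq_apply, Complex.add_re, Complex.ofReal_re,
      Complex.I_re, Complex.add_im, Complex.ofReal_im, Complex.I_im, Complex.mul_re,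
      Complex.mul_im, mul_zero, mul_one, add_zero, zero_add, sub_self]
    nlinarith
  · have h1 : Tendsto (fun y : ℝ => ‖y‖ₑ *
        eLpNorm (fun x : ℝ => ((x : ℂ) + Complex.I)⁻¹) 2 volume) (𝓝[>] 0) (𝓝 0) := by
      have h2 : Tendsto (fun y : ℝ => ‖y‖ₑ) (𝓝[>] 0) (𝓝 0) := by
        have := (continuous_enorm.tendsto (0 : ℝ)).mono_left
          (nhdsWithin_le_nhds (s := Set.Ioi 0))
        simpa using this
      have := ENNReal.Tendsto.mul_const (b := eLpNorm (fun x : ℝ => ((x : ℂ) + Complex.I)⁻¹) 2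
        volume) h2 (Or.inr hL.2.ne)
      rwa [zero_mul] at this
    refine tendsto_of_tendsto_of_tendsto_of_le_of_le' tendsto_const_nhds h1
      (Eventually.of_forall fun _ => zero_le) ?_
    filter_upwards [self_mem_nhdsWithin] with y hy
    have hy : 0 < y := hy
    refine le_trans (eLpNorm_mono fun x => ?_) (eLpNorm_const_smul_le (c := y)
      (f := fun x : ℝ => ((x : ℂ) + Complex.I)⁻¹))
    have n1 := add_I_ne_zero (z := x) (by simp)
    have n2 := add_I_ne_zero (z := (x : ℂ) + (y : ℂ) * Complex.I) (by simpa using hy.le)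
    have e : ((x : ℂ) + (y : ℂ) * Complex.I + Complex.I)⁻¹ - ((x : ℂ) + Complex.I)⁻¹ =
        ((x : ℂ) + (y : ℂ) * Complex.I + Complex.I)⁻¹ * -(y * Complex.I) *
          ((x : ℂ) + Complex.I)⁻¹ := by
      field_simp
      ring
    have h3 : ‖-((y : ℂ) * Complex.I)‖ = y := by simp [abs_of_pos hy]
    rw [e, norm_mul, norm_mul, h3, Pi.smul_apply, norm_smul, Real.norm_of_nonneg hy.le]
    refine mul_le_mul_of_nonneg_right (mul_le_of_le_one_left hy.le ?_) (norm_nonneg _)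
    rw [norm_inv]
    refine inv_le_one_of_one_le₀ ?_
    have h4 := Complex.abs_im_le_norm ((x : ℂ) + (y : ℂ) * Complex.I + Complex.I)
    rw [Complex.add_im, line_im, Complex.I_im] at h4
    exact le_trans (by linarith [le_abs_self (y + 1)]) h4

/-! ### The residue formula in H¹. -/

/-- The constant in the residue formula `∫ u(x) (x - a)⁻¹ dx = C u(a)`. -/
noncomputable def residueConst (a : ℂ) : ℂ :=
  (a - starRingEnd ℂ a) ^ 2 * ∫ x : ℝ, ((x : ℂ) - starRingEnd ℂ a)⁻¹ ^ 2 / ((x : ℂ) - a)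

/-- This is (z+i)⁻² times the square of the multiplier (z+i)/(z-β) = 1 + (β+i)/(z-β). With β = conj
a it serves as the comparison function in the residue formula. -/
theorem isHardyFun_inv_sub_sq {β : ℂ} (hβ : β.im < 0) :
    IsHardyFun 1 (fun x : ℝ => ((x : ℂ) - β)⁻¹ ^ 2) (fun z => (z - β)⁻¹ ^ 2) := by
  have ht := ((IsMultiplier.const 1).add
    ((IsMultiplier.const (β + Complex.I)).mul (isMultiplier_inv_sub hβ))).pow 2
  have h := (isHardyFun_inv_add_I.mul isHardyFun_inv_add_I).mul_multiplier le_rfl ht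
  have key : ∀ z : ℂ, 0 ≤ z.im → (1 + (β + Complex.I) * (z - β)⁻¹) ^ 2 *
      ((z + Complex.I)⁻¹ * (z + Complex.I)⁻¹) = (z - β)⁻¹ ^ 2 := by
    intro z hz
    have h1 := add_I_ne_zero hz
    have h2 := sub_ne_zero_of_im_lt (hβ.trans_le hz)
    field_simp
    ring
  exact (h.congr (Eventually.of_forall fun x => key x (by simp))).congr_extension
    fun z hz => key z (le_of_lt hz)

theorem residueFun_re_im (a : ℂ) (x : ℝ) :
    ((x : ℂ) - starRingEnd ℂ a)⁻¹ ^ 2 / ((x : ℂ) - a) =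
      ((x : ℂ) - a) * (((Complex.normSq ((x : ℂ) - a) ^ 2)⁻¹ : ℝ) : ℂ) := by
  rcases eq_or_ne ((x : ℂ) - a) 0 with h | h
  · simp [h]
  have h' : (x : ℂ) - starRingEnd ℂ a = starRingEnd ℂ ((x : ℂ) - a) := by simp
  have h2 : starRingEnd ℂ ((x : ℂ) - a) ≠ 0 := (_root_.map_ne_zero _).2 h
  rw [h']
  push_cast
  rw [Complex.normSq_eq_conj_mul_self]
  generalize starRingEnd ℂ ((x : ℂ) - a) = c at *
  field_simp

theorem integrable_residueFun {a : ℂ} (ha : 0 < a.im) :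
    Integrable fun x : ℝ => ((x : ℂ) - starRingEnd ℂ a)⁻¹ ^ 2 / ((x : ℂ) - a) := by
  have h := memLp_one_iff_integrable.1
    (isHardyFun_inv_sub_sq (β := starRingEnd ℂ a) (by simpa using ha)).memLp
  have hc : Continuous fun x : ℝ => ((x : ℂ) - a)⁻¹ :=
    Continuous.inv₀ (by fun_prop) (real_sub_ne_zero ha)
  refine (h.bdd_mul hc.aestronglyMeasurable (c := a.im⁻¹) (Eventually.of_forall fun x => ?_)).congr
    (Eventually.of_forall fun x => ?_)
  · rw [norm_inv]
    refine inv_anti₀ ha (le_trans ?_ (abs_im_le_norm_sub _))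
    simp [le_abs_self]
  · simp [div_eq_inv_mul]

/-- The prefactor (a - conj a)² is negative, and so is the imaginary part -Im a / |x-a|⁴ of the
integrand. The exact value of the constant is never needed: this sign and, for purely imaginary a,
the vanishing of the real part are enough. -/
theorem residueConst_im_pos {a : ℂ} (ha : 0 < a.im) : 0 < (residueConst a).im := by
  have h1 : (a - starRingEnd ℂ a) ^ 2 = ((-4 * a.im ^ 2 : ℝ) : ℂ) := by
    rw [Complex.sub_conj, mul_pow, Complex.I_sq]
    push_cast
    ring
  have hi := integrable_residueFun ha
  have h2 : (∫ x : ℝ, ((x : ℂ) - starRingEnd ℂ a)⁻¹ ^ 2 / ((x : ℂ) - a)).im =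
      - ∫ x : ℝ, a.im * (Complex.normSq ((x : ℂ) - a) ^ 2)⁻¹ := by
    have := Complex.imCLM.integral_comp_comm hi
    rw [Complex.imCLM_apply] at this
    rw [← this, ← integral_neg]
    refine integral_congr_ae (Eventually.of_forall fun x => ?_)
    simp only [residueFun_re_im, Complex.imCLM_apply, Complex.im_mul_ofReal, Complex.sub_im,
      Complex.ofReal_im, zero_sub, neg_mul]
  have hpos : ∀ x : ℝ, 0 < a.im * (Complex.normSq ((x : ℂ) - a) ^ 2)⁻¹ := fun x =>
    mul_pos ha (inv_pos.2 (pow_pos (Complex.normSq_pos.2 (real_sub_ne_zero ha x)) 2))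
  have h3 : 0 < ∫ x : ℝ, a.im * (Complex.normSq ((x : ℂ) - a) ^ 2)⁻¹ := by
    rw [integral_pos_iff_support_of_nonneg (fun x => (hpos x).le)]
    · have : Function.support (fun x : ℝ => a.im * (Complex.normSq ((x : ℂ) - a) ^ 2)⁻¹) =
          Set.univ := Set.eq_univ_of_forall fun x => (hpos x).ne'
      simp [this]
    · have := (Complex.imCLM.integrable_comp hi).neg
      refine this.congr (Eventually.of_forall fun x => ?_)
      simp only [residueFun_re_im, Complex.imCLM_apply, Complex.im_mul_ofReal, Complex.sub_im,
        Complex.ofReal_im, zero_sub, neg_mul, Pi.neg_apply, neg_neg]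
  rw [residueConst, h1, Complex.im_ofReal_mul, h2]
  have : 0 < 4 * a.im ^ 2 := by positivity
  nlinarith [mul_pos this h3]

theorem residueConst_ne_zero {a : ℂ} (ha : 0 < a.im) : residueConst a ≠ 0 := fun h => by
  have := residueConst_im_pos ha
  simp [h] at this

/-- For purely imaginary a the real part of the integrand is odd. -/
theorem residueConst_re {a : ℂ} (ha : 0 < a.im) (hre : a.re = 0) : (residueConst a).re = 0 := by
  have h1 : (a - starRingEnd ℂ a) ^ 2 = ((-4 * a.im ^ 2 : ℝ) : ℂ) := by
    rw [Complex.sub_conj, mul_pow, Complex.I_sq]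
    push_cast
    ring
  have h2 : (∫ x : ℝ, ((x : ℂ) - starRingEnd ℂ a)⁻¹ ^ 2 / ((x : ℂ) - a)).re =
      ∫ x : ℝ, x * (Complex.normSq ((x : ℂ) - a) ^ 2)⁻¹ := by
    have := Complex.reCLM.integral_comp_comm (integrable_residueFun ha)
    rw [Complex.reCLM_apply] at this
    rw [← this]
    refine integral_congr_ae (Eventually.of_forall fun x => ?_)
    simp only [residueFun_re_im, Complex.reCLM_apply, Complex.re_mul_ofReal, Complex.sub_re,
      Complex.ofReal_re, hre, sub_zero]
  have h3 := integral_neg_eq_self (fun x : ℝ => x * (Complex.normSq ((x : ℂ) - a) ^ 2)⁻¹) volume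
  have h4 : ∀ x : ℝ, Complex.normSq (((-x : ℝ) : ℂ) - a) = Complex.normSq ((x : ℂ) - a) := by
    intro x
    simp [Complex.normSq_apply, hre]
  simp only [h4, neg_mul, integral_neg] at h3
  rw [residueConst, h1, Complex.re_ofReal_mul, h2]
  have : ∫ x : ℝ, x * (Complex.normSq ((x : ℂ) - a) ^ 2)⁻¹ = 0 := by linarith
  rw [this, mul_zero]

namespace IsHardyFun

/-- The residue formula for the Hardy class `H¹`. -/
theorem integral_div_sub {u : ℝ → ℂ} {U : ℂ → ℂ} (h : IsHardyFun 1 u U) {a : ℂ} (ha : 0 < a.im) :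
    ∫ x : ℝ, u x / ((x : ℂ) - a) = residueConst a * U a := by
  have hg := isHardyFun_inv_sub_sq (β := starRingEnd ℂ a) (by simpa using ha)
  have hne : a - starRingEnd ℂ a ≠ 0 :=
    sub_ne_zero_of_im_lt (by simp only [Complex.conj_im]; linarith)
  -- Chosen so that u + c (z - conj a)⁻² vanishes at a; dividing by z - a then stays in H¹, where
  -- the integral is zero.
  set c := -(U a * (a - starRingEnd ℂ a) ^ 2) with hc
  have hs := h.add (hg.mul_multiplier le_rfl (IsMultiplier.const c)) le_rfl
  have h0 : U a + c * (a - starRingEnd ℂ a)⁻¹ ^ 2 = 0 := by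
    rw [hc]
    field_simp
    ring
  have hz := (hs.div_sub le_rfl ha h0).integral_eq_zero
  have hu : Integrable fun x : ℝ => u x / ((x : ℂ) - a) := by
    have hc : Continuous fun x : ℝ => ((x : ℂ) - a)⁻¹ :=
      Continuous.inv₀ (by fun_prop) (real_sub_ne_zero ha)
    refine ((memLp_one_iff_integrable.1 h.memLp).bdd_mul hc.aestronglyMeasurable (c := a.im⁻¹)
      (Eventually.of_forall fun x => ?_)).congr (Eventually.of_forall fun x => ?_)
    · rw [norm_inv]
      refine inv_anti₀ ha (le_trans ?_ (abs_im_le_norm_sub _))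
      simp [le_abs_self]
    · simp [div_eq_inv_mul]
  simp only [add_div, mul_div_assoc] at hz
  rw [integral_add hu ((integrable_residueFun ha).const_mul c), integral_const_mul] at hz
  rw [residueConst]
  linear_combination hz

/-- The factor (z+i)⁻¹ moves H² into H¹, where the residue formula recovers the value at a from
boundary values alone. -/
theorem extension_eq {f : ℝ → ℂ} {F G : ℂ → ℂ} (hF : IsHardyFun 2 f F) (hG : IsHardyFun 2 f G)
    {a : ℂ} (ha : 0 < a.im) : F a = G a := by
  have h1 := (hF.mul isHardyFun_inv_add_I).integral_div_sub ha
  rw [(hG.mul isHardyFun_inv_add_I).integral_div_sub ha] at h1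
  exact (mul_right_cancel₀ (inv_ne_zero (add_I_ne_zero ha.le))
    (mul_left_cancel₀ (residueConst_ne_zero ha) h1)).symm

end IsHardyFun

/-! ### Evaluation, multiplication and reflection as operations on H²₊. -/

namespace IsHardyFun

/-- The element of `H²₊` represented by a function. -/
noncomputable def toHardy {f : ℝ → ℂ} {F : ℂ → ℂ} (h : IsHardyFun 2 f F) : hardyPlus :=
  ⟨h.memLp.toLp f, F, (h.congr (MemLp.coeFn_toLp h.memLp).symm).isHardyExtension⟩

theorem coeFn_toHardy {f : ℝ → ℂ} {F : ℂ → ℂ} (h : IsHardyFun 2 f F) :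
    ((h.toHardy : Lp ℂ 2 (volume : Measure ℝ)) : ℝ → ℂ) =ᵐ[volume] f :=
  MemLp.coeFn_toLp h.memLp

end IsHardyFun

namespace hardyPlus

theorem ext_ae {w v : hardyPlus} (h : ((w : Lp ℂ 2 (volume : Measure ℝ)) : ℝ → ℂ) =ᵐ[volume]
    ((v : Lp ℂ 2 (volume : Measure ℝ)) : ℝ → ℂ)) : w = v :=
  Subtype.ext (Lp.ext h)

theorem coeFn_add (w v : hardyPlus) :
    (((w + v : hardyPlus) : Lp ℂ 2 (volume : Measure ℝ)) : ℝ → ℂ) =ᵐ[volume] fun x =>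
      (w : Lp ℂ 2 (volume : Measure ℝ)) x + (v : Lp ℂ 2 (volume : Measure ℝ)) x := by
  rw [Submodule.coe_add]
  exact Lp.coeFn_add _ _

theorem coeFn_smul (c : ℂ) (w : hardyPlus) :
    (((c • w : hardyPlus) : Lp ℂ 2 (volume : Measure ℝ)) : ℝ → ℂ) =ᵐ[volume] fun x =>
      c * (w : Lp ℂ 2 (volume : Measure ℝ)) x := by
  rw [Submodule.coe_smul]
  exact Lp.coeFn_smul _ _

/-- The analytic extension of an element of `H²₊` to the upper half-plane. -/
noncomputable def extension (w : hardyPlus) : ℂ → ℂ := w.2.choose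

theorem isHardyFun (w : hardyPlus) :
    IsHardyFun 2 (w : Lp ℂ 2 (volume : Measure ℝ)) (extension w) :=
  w.2.choose_spec.isHardyFun

theorem extension_eq {w : hardyPlus} {f : ℝ → ℂ} {F : ℂ → ℂ} (h : IsHardyFun 2 f F)
    (hw : ((w : Lp ℂ 2 (volume : Measure ℝ)) : ℝ → ℂ) =ᵐ[volume] f) {a : ℂ} (ha : 0 < a.im) :
    extension w a = F a :=
  ((isHardyFun w).congr hw).extension_eq h ha

/-- Evaluation of (the analytic extension of) an element of `H²₊` at a point. -/
noncomputable def eval (a : ℂ) (ha : 0 < a.im) : hardyPlus →ₗ[ℂ] ℂ where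
  toFun w := extension w a
  map_add' w v :=
    extension_eq ((isHardyFun w).add (isHardyFun v) (by norm_num)) (coeFn_add w v) ha
  map_smul' c w :=
    extension_eq ((isHardyFun w).mul_multiplier (by norm_num) (IsMultiplier.const c))
      (coeFn_smul c w) ha

theorem eval_apply (a : ℂ) (ha : 0 < a.im) (w : hardyPlus) : eval a ha w = extension w a := rfl

/-- Multiplication by a multiplier, as an operator in `H²₊`. -/
noncomputable def mulBy {m : ℂ → ℂ} (hm : IsMultiplier m) : hardyPlus →ₗ[ℂ] hardyPlus where
  toFun w := ((isHardyFun w).mul_multiplier (by norm_num) hm).toHardy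
  map_add' w v := by
    refine ext_ae ?_
    filter_upwards [((isHardyFun (w + v)).mul_multiplier (by norm_num) hm).coeFn_toHardy,
      ((isHardyFun w).mul_multiplier (by norm_num) hm).coeFn_toHardy,
      ((isHardyFun v).mul_multiplier (by norm_num) hm).coeFn_toHardy, coeFn_add w v,
      coeFn_add ((isHardyFun w).mul_multiplier (by norm_num) hm).toHardy
        ((isHardyFun v).mul_multiplier (by norm_num) hm).toHardy] with x h1 h2 h3 h4 h5
    rw [h1, h5, h2, h3, h4, mul_add]
  map_smul' c w := by
    refine ext_ae ?_
    filter_upwards [((isHardyFun (c • w)).mul_multiplier (by norm_num) hm).coeFn_toHardy,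
      ((isHardyFun w).mul_multiplier (by norm_num) hm).coeFn_toHardy, coeFn_smul c w,
      coeFn_smul c ((isHardyFun w).mul_multiplier (by norm_num) hm).toHardy] with x h1 h2 h3 h4
    rw [h1, RingHom.id_apply, h4, h2, h3]
    ring

theorem coeFn_mulBy {m : ℂ → ℂ} (hm : IsMultiplier m) (w : hardyPlus) :
    ((mulBy hm w : Lp ℂ 2 (volume : Measure ℝ)) : ℝ → ℂ) =ᵐ[volume] fun x =>
      m x * (w : Lp ℂ 2 (volume : Measure ℝ)) x :=
  ((isHardyFun w).mul_multiplier (by norm_num) hm).coeFn_toHardy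

theorem extension_mulBy {m : ℂ → ℂ} (hm : IsMultiplier m) (w : hardyPlus) {a : ℂ}
    (ha : 0 < a.im) : extension (mulBy hm w) a = m a * extension w a :=
  extension_eq ((isHardyFun w).mul_multiplier (by norm_num) hm) (coeFn_mulBy hm w) ha

theorem mulBy_mul {m n : ℂ → ℂ} (hm : IsMultiplier m) (hn : IsMultiplier n)
    (hmn : IsMultiplier fun z => m z * n z) : mulBy hmn = mulBy hm ∘ₗ mulBy hn := by
  refine LinearMap.ext fun w => ext_ae ?_
  filter_upwards [coeFn_mulBy hmn w, coeFn_mulBy hn w, coeFn_mulBy hm (mulBy hn w)]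
    with x h1 h2 h3
  rw [LinearMap.comp_apply, h1, h3, h2, mul_assoc]

theorem mulBy_injective {m : ℂ → ℂ} (hm : IsMultiplier m) (h0 : ∀ x : ℝ, m x ≠ 0) :
    Function.Injective (mulBy hm) := by
  intro w v hwv
  refine ext_ae ?_
  filter_upwards [coeFn_mulBy hm w, coeFn_mulBy hm v] with x h1 h2
  rw [hwv, h2] at h1
  exact (mul_left_cancel₀ (h0 x) h1).symm

theorem range_mulBy_mobius {a : ℂ} (ha : 0 < a.im) :
    LinearMap.range (mulBy (isMultiplier_mobius a)) = LinearMap.ker (eval a ha) := by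
  ext w
  rw [LinearMap.mem_range, LinearMap.mem_ker, eval_apply]
  constructor
  · rintro ⟨v, rfl⟩
    rw [extension_mulBy _ _ ha, mobius, sub_self, zero_div, zero_mul]
  · intro h0
    -- The preimage is w (x+i)/(x-a), written as w + (a+i) w/(x-a).
    have h1 := (isHardyFun w).add (((isHardyFun w).div_sub (by norm_num) ha h0).mul_multiplier
      (by norm_num) (IsMultiplier.const (a + Complex.I))) (by norm_num)
    refine ⟨h1.toHardy, ext_ae ?_⟩
    filter_upwards [coeFn_mulBy (isMultiplier_mobius a) h1.toHardy, h1.coeFn_toHardy]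
      with x h2 h3
    rw [h2, h3, mobius]
    have n1 := real_sub_ne_zero ha x
    have n2 := add_I_ne_zero (z := x) (by simp)
    field_simp
    ring

/-- The involution `w(x) ↦ conj w(-x)` of `H²₊`. -/
noncomputable def reflect (w : hardyPlus) : hardyPlus := (isHardyFun w).reflect.toHardy

theorem coeFn_reflect (w : hardyPlus) :
    ((reflect w : Lp ℂ 2 (volume : Measure ℝ)) : ℝ → ℂ) =ᵐ[volume] fun x =>
      starRingEnd ℂ ((w : Lp ℂ 2 (volume : Measure ℝ)) (-x)) :=
  (isHardyFun w).reflect.coeFn_toHardy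

theorem extension_reflect (w : hardyPlus) {a : ℂ} (ha : 0 < a.im) :
    extension (reflect w) a = starRingEnd ℂ (extension w (-starRingEnd ℂ a)) :=
  extension_eq (isHardyFun w).reflect (coeFn_reflect w) ha

theorem ae_neg {P : ℝ → Prop} (h : ∀ᵐ x, P x) : ∀ᵐ x : ℝ, P (-x) :=
  (Measure.measurePreserving_neg (volume : Measure ℝ)).quasiMeasurePreserving.ae h

theorem reflect_reflect (w : hardyPlus) : reflect (reflect w) = w := by
  refine ext_ae ?_
  filter_upwards [coeFn_reflect (reflect w), ae_neg (coeFn_reflect w)] with x h1 h2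
  rw [h1, h2, Complex.conj_conj, neg_neg]

theorem reflect_add (w v : hardyPlus) : reflect (w + v) = reflect w + reflect v := by
  refine ext_ae ?_
  filter_upwards [coeFn_reflect (w + v), coeFn_reflect w, coeFn_reflect v,
    ae_neg (coeFn_add w v), coeFn_add (reflect w) (reflect v)] with x h1 h2 h3 h4 h5
  rw [h1, h4, h5, h2, h3, map_add]

theorem reflect_smul (c : ℂ) (w : hardyPlus) :
    reflect (c • w) = starRingEnd ℂ c • reflect w := by
  refine ext_ae ?_
  filter_upwards [coeFn_reflect (c • w), coeFn_reflect w,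
    ae_neg (coeFn_smul c w), coeFn_smul (starRingEnd ℂ c) (reflect w)] with x h1 h2 h3 h4
  rw [h1, h4, h2, h3, map_mul]

theorem reflect_mulBy {m n : ℂ → ℂ} (hm : IsMultiplier m) (hn : IsMultiplier n)
    (h : ∀ x : ℝ, starRingEnd ℂ (m ((-x : ℝ) : ℂ)) = n x) (w : hardyPlus) :
    reflect (mulBy hm w) = mulBy hn (reflect w) := by
  refine ext_ae ?_
  filter_upwards [coeFn_reflect (mulBy hm w), coeFn_reflect w, ae_neg (coeFn_mulBy hm w),
    coeFn_mulBy hn (reflect w)] with x h1 h2 h3 h4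
  rw [h1, h4, h2, h3, map_mul, h]

/-- The function `(x + i)⁻¹` of `H²₊`, whose extension has no zeros. -/
noncomputable def base : hardyPlus := isHardyFun_inv_add_I.toHardy

theorem extension_base_ne_zero {a : ℂ} (ha : 0 < a.im) : extension base a ≠ 0 := by
  rw [base, extension_eq isHardyFun_inv_add_I isHardyFun_inv_add_I.coeFn_toHardy ha]
  exact inv_ne_zero (add_I_ne_zero ha.le)

end hardyPlus

/-! ### Residues of the symbol. -/

section SimpleFraction

variable {α : ℂ} {K : ℕ} {Q : ℂ[X]}

/-- The coefficient of the leading residue of the symbol at a pole. -/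
noncomputable def poleCoeff (α : ℂ) (K : ℕ) (Q : ℂ[X]) : ℂ :=
  residueConst (Complex.I * α) * (-Complex.I) ^ (K + 1) * Q.eval (-Complex.I * α) /
    (Complex.I * α + Complex.I) ^ K

theorem I_mul_im_pos (hα : 0 < α.re) : 0 < (Complex.I * α).im := by simpa using hα

/-- Since α + ix = i(x - iα), the pole is at iα. Of its K+1 factors, K are paired with powers of x+i
to form inverse Möbius factors, and a single simple pole remains for the residue formula. -/
theorem fraction_eq (hα : 0 < α.re) (x : ℝ) :
    Q.eval ((-x : ℝ) : ℂ) / (α - Complex.I * ((-x : ℝ) : ℂ)) ^ (K + 1) =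
      (-Complex.I) ^ (K + 1) * (Q.eval (-(x : ℂ)) / ((x : ℂ) + Complex.I) ^ K) *
      ((mobius (Complex.I * α) x)⁻¹) ^ K / ((x : ℂ) - Complex.I * α) := by
  have n1 := real_sub_ne_zero (I_mul_im_pos hα) x
  have n2 := add_I_ne_zero (z := x) (by simp)
  have e : α - Complex.I * ((-x : ℝ) : ℂ) = Complex.I * ((x : ℂ) - Complex.I * α) := by
    push_cast
    linear_combination α * Complex.I_sq
  have e2 : (-Complex.I) ^ (K + 1) = (Complex.I ^ (K + 1))⁻¹ := by
    rw [← inv_pow, Complex.inv_I]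
  have n3 := Complex.I_ne_zero
  rw [e, e2, mobius, mul_pow]
  push_cast
  rw [inv_div, div_pow]
  field_simp
  ring

theorem fraction_bounded (hα : 0 < α.re) (hQ : Q.natDegree ≤ K) :
    (Continuous fun x : ℝ => Q.eval ((-x : ℝ) : ℂ) / (α - Complex.I * ((-x : ℝ) : ℂ)) ^ (K + 1)) ∧
    ∃ C : ℝ, ∀ x : ℝ,
      ‖Q.eval ((-x : ℝ) : ℂ) / (α - Complex.I * ((-x : ℝ) : ℂ)) ^ (K + 1)‖ ≤ C := by
  have ha := I_mul_im_pos hα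
  constructor
  · refine Continuous.div (by fun_prop) (by fun_prop) fun x h0 => ?_
    have h1 := congrArg Complex.re (pow_eq_zero_iff (Nat.succ_ne_zero K) |>.1 h0)
    simp at h1
    linarith
  · obtain ⟨C, hC⟩ := (isMultiplier_polynomial_div hQ).bounded
    set a := Complex.I * α
    have hinv : ∀ x : ℝ, ‖((x : ℂ) - a)⁻¹‖ ≤ a.im⁻¹ := fun x => by
      rw [norm_inv]
      refine inv_anti₀ ha (le_trans ?_ (abs_im_le_norm_sub _))
      simp [le_abs_self]
    have hmob : ∀ x : ℝ, ‖(mobius a x)⁻¹‖ ≤ 1 + ‖a + Complex.I‖ * a.im⁻¹ := fun x => by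
      have e : (mobius a x)⁻¹ = 1 + (a + Complex.I) * ((x : ℂ) - a)⁻¹ := by
        have n1 := real_sub_ne_zero ha x
        rw [mobius, inv_div]
        field_simp
        ring
      rw [e]
      refine (norm_add_le _ _).trans ?_
      rw [norm_one, norm_mul]
      gcongr
      exact hinv x
    refine ⟨1 * C * (1 + ‖a + Complex.I‖ * a.im⁻¹) ^ K * a.im⁻¹, fun x => ?_⟩
    rw [fraction_eq hα, div_eq_mul_inv, norm_mul, norm_mul, norm_mul, norm_pow, norm_pow, norm_neg,
      Complex.norm_I, one_pow]
    gcongr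
    exacts [hC x (by simp), hmob x, hinv x]

/-- K Möbius factors reduce the pole to a simple one; any further factor vanishes at iα and kills
the residue. -/
theorem integral_fraction_mul (hα : 0 < α.re) (hQ : Q.natDegree ≤ K) {u : ℝ → ℂ} {U : ℂ → ℂ}
    (h : IsHardyFun 1 u U) {j : ℕ} (hj : K ≤ j) :
    ∫ x : ℝ, Q.eval ((-x : ℝ) : ℂ) / (α - Complex.I * ((-x : ℝ) : ℂ)) ^ (K + 1) *
      (mobius (Complex.I * α) x ^ j * u x) =
      if j = K then poleCoeff α K Q * U (Complex.I * α) else 0 := by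
  have ha := I_mul_im_pos hα
  have hq := isMultiplier_polynomial_div hQ
  obtain ⟨d, rfl⟩ := Nat.exists_eq_add_of_le hj
  have hu := h.mul_multiplier le_rfl (((IsMultiplier.const ((-Complex.I) ^ (K + 1))).mul hq).mul
    ((isMultiplier_mobius (Complex.I * α)).pow d))
  have key : ∀ x : ℝ, Q.eval ((-x : ℝ) : ℂ) / (α - Complex.I * ((-x : ℝ) : ℂ)) ^ (K + 1) *
      (mobius (Complex.I * α) x ^ (K + d) * u x) =
      ((-Complex.I) ^ (K + 1) * (Q.eval (-(x : ℂ)) / ((x : ℂ) + Complex.I) ^ K) *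
        mobius (Complex.I * α) x ^ d * u x) / ((x : ℂ) - Complex.I * α) := by
    intro x
    have := mobius_real_ne_zero ha x
    rw [fraction_eq hα, pow_add, inv_pow]
    generalize mobius (Complex.I * α) x = r at *
    field_simp
    ring
  simp only [key]
  rw [hu.integral_div_sub ha]
  rcases eq_or_ne d 0 with rfl | hd
  · rw [poleCoeff]
    simp only [pow_zero, mul_one, add_zero, if_true, neg_mul]
    ring
  · rw [if_neg (by omega), mobius, sub_self, zero_div, zero_pow hd, mul_zero, zero_mul, mul_zero]

end SimpleFraction

section Symbol

variable {M : ℕ} {α : Fin M → ℂ} {K : Fin M → ℕ} {Q : Fin M → ℂ[X]}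

/-- The Blaschke-type product with zeros at the reflected poles `i αₘ`. -/
noncomputable def mobiusProd (α : Fin M → ℂ) (o : Fin M → ℕ) (z : ℂ) : ℂ :=
  ∏ m, mobius (Complex.I * α m) z ^ o m

theorem isMultiplier_mobiusProd (α : Fin M → ℂ) (o : Fin M → ℕ) :
    IsMultiplier (mobiusProd α o) :=
  IsMultiplier.prod _ fun m _ => (isMultiplier_mobius (Complex.I * α m)).pow (o m)

theorem mobiusProd_add (α : Fin M → ℂ) (o e : Fin M → ℕ) (z : ℂ) :
    mobiusProd α (o + e) z = mobiusProd α o z * mobiusProd α e z := by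
  simp only [mobiusProd, Pi.add_apply, pow_add, Finset.prod_mul_distrib]

theorem symbol_bounded (hα : ∀ m, 0 < (α m).re) (hdeg : ∀ m, (Q m).natDegree ≤ K m) :
    (Continuous fun x : ℝ => rationalSymbol α K Q (-x)) ∧
    ∃ C : ℝ, ∀ x : ℝ, ‖rationalSymbol α K Q (-x)‖ ≤ C := by
  constructor
  · exact continuous_finsetSum _ fun m _ => (fraction_bounded (hα m) (hdeg m)).1
  · choose C hC using fun m => (fraction_bounded (hα m) (hdeg m)).2
    exact ⟨∑ m, C m, fun x => norm_sum_le_of_le _ fun m _ => hC m x⟩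

theorem integrable_symbol_mul (hα : ∀ m, 0 < (α m).re) (hdeg : ∀ m, (Q m).natDegree ≤ K m)
    {u : ℝ → ℂ} (hu : Integrable u) :
    Integrable fun x : ℝ => rationalSymbol α K Q (-x) * u x := by
  obtain ⟨hc, C, hC⟩ := symbol_bounded hα hdeg
  exact hu.bdd_mul hc.aestronglyMeasurable (c := C) (Eventually.of_forall hC)

/-- The residue evaluation of the integral of the symbol against an `H¹` function which vanishes
to almost the full order at the poles. -/
theorem integral_symbol_mul (hα : ∀ m, 0 < (α m).re) (hdeg : ∀ m, (Q m).natDegree ≤ K m)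
    {o : Fin M → ℕ} (ho : ∀ m, K m ≤ o m) {u : ℝ → ℂ} {U : ℂ → ℂ} (h : IsHardyFun 1 u U) :
    ∫ x : ℝ, rationalSymbol α K Q (-x) * (mobiusProd α o x * u x) =
      ∑ m with o m = K m, poleCoeff (α m) (K m) (Q m) *
        ((∏ n ∈ Finset.univ.erase m, mobius (Complex.I * α n) (Complex.I * α m) ^ o n) *
          U (Complex.I * α m)) := by
  have hu := memLp_one_iff_integrable.1 (h.mul_multiplier le_rfl (isMultiplier_mobiusProd α o)).memLp
  simp only [rationalSymbol, Finset.sum_mul]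
  rw [integral_finsetSum _ fun m _ => ?_, Finset.sum_filter]
  · refine Finset.sum_congr rfl fun m _ => ?_
    have hm := h.mul_multiplier le_rfl (IsMultiplier.prod (Finset.univ.erase m)
      fun n _ => (isMultiplier_mobius (Complex.I * α n)).pow (o n))
    rw [← integral_fraction_mul (hα m) (hdeg m) hm (ho m)]
    refine integral_congr_ae (Eventually.of_forall fun x => ?_)
    simp only [mobiusProd]
    rw [← Finset.mul_prod_erase _ _ (Finset.mem_univ m), mul_assoc]
  · obtain ⟨hc, C, hC⟩ := fraction_bounded (hα m) (hdeg m)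
    exact hu.bdd_mul hc.aestronglyMeasurable (c := C) (Eventually.of_forall hC)

end Symbol

theorem ENat.summable {ι : Type*} (f : ι → ℕ∞) : Summable f :=
  ⟨_, hasSum_of_isLUB _ (isLUB_sSup _)⟩

/-! ### Codimensions and eigenvalue counts in linear algebra. -/

section RankQuotient

variable {E : Type*} [AddCommGroup E] [Module ℂ E]

/-- In the chain ABE ⊆ AE ⊆ E, injectivity of A identifies AE/ABE with E/BE. -/
theorem rank_quotient_range_comp {A B : E →ₗ[ℂ] E} (hA : Function.Injective A) :
    Module.rank ℂ (E ⧸ LinearMap.range (A ∘ₗ B)) =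
      Module.rank ℂ (E ⧸ LinearMap.range A) + Module.rank ℂ (E ⧸ LinearMap.range B) := by
  have hle : LinearMap.range (A ∘ₗ B) ≤ LinearMap.range A := LinearMap.range_comp_le_range B A
  set X := LinearMap.range (A ∘ₗ B) with hX
  set Y := LinearMap.range A with hY
  rw [← Submodule.rank_quotient_add_rank (Y.map X.mkQ)]
  congr 1
  · exact (Submodule.quotientQuotientEquivQuotient X Y hle).rank_eq
  · have h1 : Y.map X.mkQ = LinearMap.range (X.mkQ ∘ₗ A) := by
      rw [LinearMap.range_comp]
    have h2 : LinearMap.ker (X.mkQ ∘ₗ A) = LinearMap.range B := by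
      rw [LinearMap.ker_comp, Submodule.ker_mkQ, hX, LinearMap.range_comp]
      exact Submodule.comap_map_eq_of_injective hA _
    rw [h1, ← h2]
    exact (LinearMap.quotKerEquivRange (X.mkQ ∘ₗ A)).rank_eq.symm

end RankQuotient

section EigenvalueCount

variable {E : Type*} [NormedAddCommGroup E] [InnerProductSpace ℂ E] {T : E →ₗ[ℂ] E}

/-- The number of eigenvalues of one sign is at most the codimension of a subspace on which the
quadratic form has the opposite sign. -/
theorem eigenvalueCount_le_finrank_quotient (hT : T.IsSymmetric) {S : Set ℝ} {ε : ℝ}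
    (hS : ∀ μ ∈ S, ε * μ < 0) (X : Submodule ℂ E) [Module.Finite ℂ (E ⧸ X)]
    (hX : ∀ x ∈ X, 0 ≤ ε * (inner ℂ x (T x)).re) :
    eigenvalueCount T S ≤ Module.finrank ℂ (E ⧸ X) := by
  -- For a sum x of eigenvectors from distinct eigenspaces, orthogonality gives ε(Tx, x) = ∑
  -- εμ‖l_μ‖², which is negative unless every term vanishes; membership in X forbids that.
  have key : ∀ s : Finset S, ∀ l : ∀ μ : S, Module.End.eigenspace T ((μ : ℝ) : ℂ),
      ∑ μ ∈ s, (l μ : E) ∈ X → ∀ μ ∈ s, l μ = 0 := by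
    intro s l hl
    have hinj : Function.Injective fun μ : S => ((μ : ℝ) : ℂ) :=
      Complex.ofReal_injective.comp Subtype.val_injective
    have horth := (hT.orthogonalFamily_eigenspaces).comp hinj
    have h1 := hX _ hl
    have h2 : T (∑ μ ∈ s, (l μ : E)) = ∑ μ ∈ s, ((((μ : ℝ) : ℂ) • l μ : _) : E) := by
      rw [map_sum]
      exact Finset.sum_congr rfl fun μ _ => Module.End.mem_eigenspace_iff.1 (l μ).2
    have h3 := horth.inner_sum l (fun μ => ((μ : ℝ) : ℂ) • l μ) s
    simp only [Submodule.coe_subtypeₗᵢ, Submodule.subtype_apply] at h3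
    rw [h2] at h1
    erw [h3] at h1
    have h4 : ∀ μ : S, (inner ℂ (l μ) (((μ : ℝ) : ℂ) • l μ)).re = (μ : ℝ) * ‖l μ‖ ^ 2 := by
      intro μ
      rw [inner_smul_right, inner_self_eq_norm_sq_to_K, Complex.re_ofReal_mul]
      norm_cast
    rw [Complex.re_sum, Finset.mul_sum] at h1
    simp only [h4, ← mul_assoc] at h1
    intro μ hμ
    by_contra hne
    have hneg : ∑ ν ∈ s, ε * (ν : ℝ) * ‖l ν‖ ^ 2 < 0 := by
      refine Finset.sum_neg' (fun ν _ => ?_) ⟨μ, hμ, ?_⟩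
      · exact mul_nonpos_of_nonpos_of_nonneg (hS ν ν.2).le (sq_nonneg _)
      · exact mul_neg_of_neg_of_pos (hS μ μ.2) (pow_pos (norm_pos_iff.2 hne) 2)
    linarith
  have hfin : ∀ μ : S, Module.Finite ℂ (Module.End.eigenspace T ((μ : ℝ) : ℂ)) := by
    intro μ
    refine Module.Finite.of_injective (X.mkQ ∘ₗ (Module.End.eigenspace T ((μ : ℝ) : ℂ)).subtype) ?_
    rw [← LinearMap.ker_eq_bot, LinearMap.ker_eq_bot']
    intro x hx
    classical
    have := key {μ} (Function.update 0 μ x) (by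
      rw [Finset.sum_singleton, Function.update_self]
      exact (Submodule.Quotient.mk_eq_zero X).1 hx) μ (by simp)
    rwa [Function.update_self] at this
  refine (ENat.summable _).tsum_le_of_sum_le fun s => ?_
  let φ : (∀ μ : s, Module.End.eigenspace T ((μ : ℝ) : ℂ)) →ₗ[ℂ] E ⧸ X :=
    X.mkQ ∘ₗ ∑ μ : s, (Module.End.eigenspace T ((μ : ℝ) : ℂ)).subtype ∘ₗ LinearMap.proj μ
  have hφ : Function.Injective φ := by
    rw [← LinearMap.ker_eq_bot, LinearMap.ker_eq_bot']
    intro x hx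
    classical
    have hx' := (Submodule.Quotient.mk_eq_zero X).1 hx
    have := key s (fun μ => if h : μ ∈ s then x ⟨μ, h⟩ else 0) (by
      rw [← Finset.sum_coe_sort]
      simpa using hx')
    funext μ
    simpa using this μ μ.2
  have hle := LinearMap.finrank_le_finrank_of_injective hφ
  rw [Module.finrank_pi_fintype] at hle
  have e : ∀ μ : S, Cardinal.toENat (Module.rank ℂ (Module.End.eigenspace T ((μ : ℝ) : ℂ))) =
      Module.finrank ℂ (Module.End.eigenspace T ((μ : ℝ) : ℂ)) := by
    intro μ
    rw [← Module.finrank_eq_rank]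
    simp
  simp only [e]
  rw [← Finset.sum_coe_sort]
  exact_mod_cast hle

/-- Grouping the eigenvalue list of the restriction by value turns each group into the dimension of
an eigenspace of the restriction, which embeds in the eigenspace of `T`. -/
theorem card_eigenvalues_le_eigenvalueCount {V : Submodule ℂ E} [FiniteDimensional ℂ V]
    (hV : ∀ x ∈ V, T x ∈ V) (hT' : (T.restrict hV).IsSymmetric) {n : ℕ}
    (hn : Module.finrank ℂ V = n) (S : Set ℝ) [DecidablePred (· ∈ S)] :
    ((Finset.univ.filter fun i => hT'.eigenvalues hn i ∈ S).card : ℕ∞) ≤ eigenvalueCount T S := by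
  classical
  set A := Finset.univ.filter fun i => hT'.eigenvalues hn i ∈ S with hA
  have hAS : ∀ b ∈ A.image (hT'.eigenvalues hn), b ∈ S := by
    intro b hb
    obtain ⟨i, hi, rfl⟩ := Finset.mem_image.1 hb
    exact (Finset.mem_filter.1 hi).2
  rw [Finset.card_eq_sum_card_image (hT'.eigenvalues hn) A, Nat.cast_sum]
  refine le_trans (Finset.sum_le_sum fun b _ => ?_) (le_trans (le_of_eq
    (Finset.sum_subtype_of_mem (fun μ : ℝ =>
      Cardinal.toENat (Module.rank ℂ (Module.End.eigenspace T (μ : ℂ)))) hAS).symm)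
    ((ENat.summable _).sum_le_tsum _ fun _ _ => zero_le))
  have h1 : (A.filter fun i => hT'.eigenvalues hn i = b).card ≤
      Module.finrank ℂ (Module.End.eigenspace (T.restrict hV) (b : ℂ)) := by
    rw [← hT'.card_filter_eigenvalues_eq hn (b : ℂ)]
    refine Finset.card_le_card fun i hi => ?_
    simp [(Finset.mem_filter.1 hi).2]
  have h2 : Module.rank ℂ (Module.End.eigenspace (T.restrict hV) (b : ℂ)) ≤
      Module.rank ℂ (Module.End.eigenspace T (b : ℂ)) := by
    refine LinearMap.rank_le_of_injective ((V.subtype.domRestrict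
      (Module.End.eigenspace (T.restrict hV) (b : ℂ))).codRestrict _ fun x => ?_) ?_
    · exact Module.End.mem_eigenspace_iff.2
        (congrArg Subtype.val (Module.End.mem_eigenspace_iff.1 x.2))
    · intro x y hxy
      have hxy' : ((x : V) : E) = ((y : V) : E) :=
        congrArg (Module.End.eigenspace T (b : ℂ)).subtype hxy
      exact Subtype.ext (Subtype.ext hxy')
  refine le_trans (Nat.cast_le.2 h1) (le_trans (le_of_eq ?_) (Cardinal.toENat.monotone' h2))
  rw [← Module.finrank_eq_rank]
  simp

/-- A symmetric operator is injective on its range: if Tb = 0 and b = Ty, then (b, b) = (y, Tb) = 0.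
So every eigenvalue of the restriction to the range is nonzero and has a sign. -/
theorem finrank_range_le_eigenvalueCount_add (hT : T.IsSymmetric)
    [FiniteDimensional ℂ (LinearMap.range T)] :
    (Module.finrank ℂ (LinearMap.range T) : ℕ∞) ≤
      eigenvalueCount T (Set.Ioi 0) + eigenvalueCount T (Set.Iio 0) := by
  classical
  have hV : ∀ x ∈ LinearMap.range T, T x ∈ LinearMap.range T := fun x _ => ⟨x, rfl⟩
  have hT' := hT.restrict_invariant hV
  obtain ⟨n, hn⟩ : ∃ n, Module.finrank ℂ (LinearMap.range T) = n := ⟨_, rfl⟩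
  rw [hn]
  refine le_trans ?_ (add_le_add (card_eigenvalues_le_eigenvalueCount hV hT' hn (Set.Ioi 0))
    (card_eigenvalues_le_eigenvalueCount hV hT' hn (Set.Iio 0)))
  norm_cast
  rw [← Finset.card_union_of_disjoint]
  · refine le_trans (le_of_eq (Finset.card_fin n).symm) (Finset.card_le_card fun i _ => ?_)
    have h0 : hT'.eigenvalues hn i ≠ 0 := by
      intro h0
      have h1 := hT'.apply_eigenvectorBasis hn i
      rw [h0] at h1
      simp only [Complex.coe_algebraMap, Complex.ofReal_zero, zero_smul] at h1
      set b := hT'.eigenvectorBasis hn i with hb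
      have hb0 : (b : E) ≠ 0 := by
        have := (hT'.eigenvectorBasis hn).orthonormal.ne_zero i
        simpa using this
      obtain ⟨y, hy⟩ := b.2
      have h2 : T b = 0 := congrArg Subtype.val h1
      have h3 : inner ℂ (b : E) (b : E) = 0 := by
        conv_lhs => rw [← hy]
        rw [hT, hy, h2, inner_zero_right]
      exact hb0 (inner_self_eq_zero.1 h3)
    rcases lt_or_gt_of_ne h0 with h | h
    · simp [h]
    · simp [h]
  · rw [Finset.disjoint_filter]
    intro i _ h1 h2
    exact lt_asymm (Set.mem_Ioi.1 h1) (Set.mem_Iio.1 h2)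

end EigenvalueCount

/-! ### Codimension of the subspaces with prescribed zeros. -/

namespace hardyPlus

theorem mulBy_congr {m n : ℂ → ℂ} (hm : IsMultiplier m) (hn : IsMultiplier n)
    (h : ∀ x : ℝ, m x = n x) : mulBy hm = mulBy hn := by
  refine LinearMap.ext fun w => ext_ae ?_
  filter_upwards [coeFn_mulBy hm w, coeFn_mulBy hn w] with x h1 h2
  rw [h1, h2, h]

theorem mulBy_one {m : ℂ → ℂ} (hm : IsMultiplier m) (h : ∀ x : ℝ, m x = 1) :
    mulBy hm = LinearMap.id := by
  refine LinearMap.ext fun w => ext_ae ?_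
  filter_upwards [coeFn_mulBy hm w] with x h1
  rw [h1, h, one_mul, LinearMap.id_apply]

theorem rank_quotient_range_mulBy_one {m : ℂ → ℂ} (hm : IsMultiplier m) (h : ∀ x : ℝ, m x = 1) :
    Module.rank ℂ (hardyPlus ⧸ LinearMap.range (mulBy hm)) = 0 := by
  rw [mulBy_one hm h, LinearMap.range_id]
  exact rank_subsingleton' _ _

theorem rank_quotient_range_mobius {a : ℂ} (ha : 0 < a.im) :
    Module.rank ℂ (hardyPlus ⧸ LinearMap.range (mulBy (isMultiplier_mobius a))) = 1 := by
  rw [range_mulBy_mobius ha]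
  have hs : Function.Surjective (eval a ha) := by
    intro c
    refine ⟨(c / extension base a) • base, ?_⟩
    rw [map_smul, eval_apply, smul_eq_mul, div_mul_cancel₀ _ (extension_base_ne_zero ha)]
  rw [((eval a ha).quotKerEquivOfSurjective hs).rank_eq, Module.rank_self]

theorem rank_quotient_range_mobius_pow {a : ℂ} (ha : 0 < a.im) (k : ℕ) :
    Module.rank ℂ (hardyPlus ⧸ LinearMap.range (mulBy ((isMultiplier_mobius a).pow k))) = k := by
  induction k with
  | zero => exact_mod_cast rank_quotient_range_mulBy_one _ fun x => pow_zero _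
  | succ k ih =>
    have h := mulBy_mul ((isMultiplier_mobius a).pow k) (isMultiplier_mobius a)
      (((isMultiplier_mobius a).pow k).mul (isMultiplier_mobius a))
    rw [mulBy_congr _ (((isMultiplier_mobius a).pow k).mul (isMultiplier_mobius a))
      fun x => pow_succ _ _, h, rank_quotient_range_comp (mulBy_injective ((isMultiplier_mobius a).pow k) fun x =>
        pow_ne_zero _ (mobius_real_ne_zero ha x)), ih, rank_quotient_range_mobius ha]
    push_cast
    rfl

end hardyPlus

open hardyPlus

/-! ### The Hankel form on functions with prescribed zeros. -/

section Form

variable {M : ℕ} {α : Fin M → ℂ} {K : Fin M → ℕ} {Q : Fin M → ℂ[X]}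

/-- Multiplication by `mobiusProd α o` in the Hardy space. -/
noncomputable def mulProd (α : Fin M → ℂ) (o : Fin M → ℕ) : hardyPlus →ₗ[ℂ] hardyPlus :=
  mulBy (isMultiplier_mobiusProd α o)

theorem mulProd_add (o e : Fin M → ℕ) : mulProd α (o + e) = mulProd α o ∘ₗ mulProd α e := by
  rw [mulProd, mulBy_congr _ ((isMultiplier_mobiusProd α o).mul (isMultiplier_mobiusProd α e))
    fun x => mobiusProd_add α o e x]
  exact mulBy_mul _ _ _

theorem mulProd_single (m : Fin M) :
    mulProd α (Pi.single m 1) = mulBy (isMultiplier_mobius (Complex.I * α m)) := by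
  refine mulBy_congr _ _ fun x => ?_
  rw [mobiusProd, Finset.prod_eq_single m]
  · simp
  · intro n _ hn
    simp [Pi.single_eq_of_ne hn]
  · simp

theorem rank_quotient_range_mulProd (hα : ∀ m, 0 < (α m).re) (o : Fin M → ℕ) :
    Module.rank ℂ (hardyPlus ⧸ LinearMap.range (mulProd α o)) = (∑ m, o m : ℕ) := by
  classical
  have key : ∀ s : Finset (Fin M), Module.rank ℂ (hardyPlus ⧸ LinearMap.range (mulBy
      (IsMultiplier.prod s fun m _ => (isMultiplier_mobius (Complex.I * α m)).pow (o m)))) =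
      (∑ m ∈ s, o m : ℕ) := by
    intro s
    induction s using Finset.induction_on with
    | empty => exact_mod_cast rank_quotient_range_mulBy_one _ fun x => Finset.prod_empty
    | insert i s hi ih =>
      have h1 := (isMultiplier_mobius (Complex.I * α i)).pow (o i)
      have h2 := IsMultiplier.prod s fun m _ => (isMultiplier_mobius (Complex.I * α m)).pow (o m)
      rw [mulBy_congr _ (h1.mul h2) fun x => Finset.prod_insert hi, mulBy_mul h1 h2,
        rank_quotient_range_comp (mulBy_injective h1 fun x =>
          pow_ne_zero _ (mobius_real_ne_zero (I_mul_im_pos (hα i)) x)), ih,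
        rank_quotient_range_mobius_pow (I_mul_im_pos (hα i)), Finset.sum_insert hi]
      push_cast
      rfl
  exact key Finset.univ

theorem finite_quotient_range_mulProd (hα : ∀ m, 0 < (α m).re) (o : Fin M → ℕ) :
    Module.Finite ℂ (hardyPlus ⧸ LinearMap.range (mulProd α o)) := by
  rw [← Module.rank_lt_aleph0_iff, rank_quotient_range_mulProd hα]
  exact Cardinal.natCast_lt_aleph0

theorem finrank_quotient_range_mulProd (hα : ∀ m, 0 < (α m).re) (o : Fin M → ℕ) :
    Module.finrank ℂ (hardyPlus ⧸ LinearMap.range (mulProd α o)) = ∑ m, o m :=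
  Module.finrank_eq_of_rank_eq (rank_quotient_range_mulProd hα o)

/-- The bilinear form `∫ φ(-x) w(x) u(x) dx` in the Hardy space. -/
noncomputable def symbolForm (α : Fin M → ℂ) (K : Fin M → ℕ) (Q : Fin M → ℂ[X])
    (w u : hardyPlus) : ℂ :=
  ∫ x : ℝ, rationalSymbol α K Q (-x) * ((w : Lp ℂ 2 (volume : Measure ℝ)) x *
    (u : Lp ℂ 2 (volume : Measure ℝ)) x)

theorem symbolForm_comm (w u : hardyPlus) : symbolForm α K Q w u = symbolForm α K Q u w := by
  simp only [symbolForm, mul_comm (((w : Lp ℂ 2 (volume : Measure ℝ)) : ℝ → ℂ) _)]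

theorem symbolForm_add (hα : ∀ m, 0 < (α m).re) (hdeg : ∀ m, (Q m).natDegree ≤ K m)
    (w v u : hardyPlus) :
    symbolForm α K Q (w + v) u = symbolForm α K Q w u + symbolForm α K Q v u := by
  have hi : ∀ w : hardyPlus, Integrable fun x => rationalSymbol α K Q (-x) *
      ((w : Lp ℂ 2 (volume : Measure ℝ)) x * (u : Lp ℂ 2 (volume : Measure ℝ)) x) := fun w =>
    integrable_symbol_mul hα hdeg
      (memLp_one_iff_integrable.1 ((isHardyFun w).mul (isHardyFun u)).memLp)
  rw [symbolForm, symbolForm, symbolForm, ← integral_add (hi w) (hi v)]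
  refine integral_congr_ae ?_
  filter_upwards [coeFn_add w v] with x hx
  rw [hx]
  ring

theorem symbolForm_smul (c : ℂ) (w u : hardyPlus) :
    symbolForm α K Q (c • w) u = c * symbolForm α K Q w u := by
  rw [symbolForm, symbolForm, ← integral_const_mul]
  refine integral_congr_ae ?_
  filter_upwards [coeFn_smul c w] with x hx
  rw [hx]
  ring

theorem symbolForm_mulProd_right (o : Fin M → ℕ) (w u : hardyPlus) :
    symbolForm α K Q w (mulProd α o u) = symbolForm α K Q (mulProd α o w) u := by
  refine integral_congr_ae ?_
  filter_upwards [coeFn_mulBy (isMultiplier_mobiusProd α o) w,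
    coeFn_mulBy (isMultiplier_mobiusProd α o) u] with x h1 h2
  rw [mulProd, h1, h2]
  ring

theorem symbolForm_mulProd (hα : ∀ m, 0 < (α m).re) (hdeg : ∀ m, (Q m).natDegree ≤ K m)
    {o : Fin M → ℕ} (ho : ∀ m, K m ≤ o m) (w u : hardyPlus) :
    symbolForm α K Q (mulProd α o w) u =
      ∑ m with o m = K m, poleCoeff (α m) (K m) (Q m) *
        ((∏ n ∈ Finset.univ.erase m, mobius (Complex.I * α n) (Complex.I * α m) ^ o n) *
          (extension w (Complex.I * α m) * extension u (Complex.I * α m))) := by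
  rw [← integral_symbol_mul hα hdeg ho ((isHardyFun w).mul (isHardyFun u))]
  refine integral_congr_ae ?_
  filter_upwards [coeFn_mulBy (isMultiplier_mobiusProd α o) w] with x h1
  rw [mulProd, h1, mul_assoc]

theorem symbolForm_mulProd_eq_zero (hα : ∀ m, 0 < (α m).re)
    (hdeg : ∀ m, (Q m).natDegree ≤ K m) {o : Fin M → ℕ} (ho : ∀ m, K m < o m) (w u : hardyPlus) :
    symbolForm α K Q (mulProd α o w) u = 0 := by
  rw [symbolForm_mulProd hα hdeg fun m => (ho m).le, Finset.filter_false_of_mem,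
    Finset.sum_empty]
  exact fun m _ => (ho m).ne'

/-- The main test device: full vanishing at every pole but one isolates a single residue. -/
theorem symbolForm_mulProd_single (hα : ∀ m, 0 < (α m).re)
    (hdeg : ∀ m, (Q m).natDegree ≤ K m) {o : Fin M → ℕ} {μ : Fin M} (hμ : o μ = K μ)
    (ho : ∀ m, m ≠ μ → K m < o m) (w u : hardyPlus) :
    symbolForm α K Q (mulProd α o w) u = poleCoeff (α μ) (K μ) (Q μ) *
        ((∏ n ∈ Finset.univ.erase μ, mobius (Complex.I * α n) (Complex.I * α μ) ^ o n) *
          (extension w (Complex.I * α μ) * extension u (Complex.I * α μ))) := by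
  rw [symbolForm_mulProd hα hdeg fun m => ?_]
  · have : (Finset.univ.filter fun m => o m = K m) = {μ} := by
      ext m
      simp only [Finset.mem_filter, Finset.mem_univ, true_and, Finset.mem_singleton]
      refine ⟨fun h => ?_, fun h => h ▸ hμ⟩
      by_contra hne
      exact (ho m hne).ne' h
    rw [this, Finset.sum_singleton]
  · rcases eq_or_ne m μ with rfl | h
    · exact hμ.ge
    · exact (ho m h).le

theorem poleCoeff_ne_zero {α : ℂ} {K : ℕ} {Q : ℂ[X]} (hα : 0 < α.re)
    (hQ : Q.eval (-Complex.I * α) ≠ 0) : poleCoeff α K Q ≠ 0 := by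
  have ha := I_mul_im_pos hα
  exact div_ne_zero (mul_ne_zero (mul_ne_zero (residueConst_ne_zero ha)
    (pow_ne_zero _ (neg_ne_zero.2 Complex.I_ne_zero))) hQ)
    (pow_ne_zero _ (add_I_ne_zero ha.le))

theorem prod_mobius_ne_zero (hα : ∀ m, 0 < (α m).re) (hαinj : Function.Injective α)
    (o : Fin M → ℕ) (μ : Fin M) :
    ∏ n ∈ Finset.univ.erase μ, mobius (Complex.I * α n) (Complex.I * α μ) ^ o n ≠ 0 := by
  refine Finset.prod_ne_zero_iff.2 fun n hn => pow_ne_zero _ (mobius_ne_zero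
    (I_mul_im_pos (hα μ)).le fun h => Finset.ne_of_mem_erase hn ?_)
  exact (hαinj (mul_left_cancel₀ Complex.I_ne_zero h)).symm

/-- A sesquilinear map vanishing on the diagonal vanishes. -/
theorem sesquilinear_eq_zero {E : Type*} [AddCommGroup E] [Module ℂ E] (f : E → E → ℂ)
    (hl : ∀ w v u, f (w + v) u = f w u + f v u) (hr : ∀ w v u, f w (v + u) = f w v + f w u)
    (hsl : ∀ (c : ℂ) w u, f (c • w) u = c * f w u)
    (hsr : ∀ (c : ℂ) w u, f w (c • u) = starRingEnd ℂ c * f w u)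
    (h0 : ∀ w, f w w = 0) (w u : E) : f w u = 0 := by
  have h1 := h0 (w + u)
  have h2 := h0 (w + Complex.I • u)
  simp only [hl, hr, hsl, hsr, h0, Complex.conj_I, mul_zero, add_zero, zero_add] at h1 h2
  have h3 : 2 * Complex.I * f w u = 0 := by linear_combination Complex.I * h1 - h2
  simpa using h3

/-- The definition gives only the diagonal, which determines a sesquilinear form by polarisation. In
terms of the reflected second argument the form is bilinear and symmetric, so multipliers can be
moved between its arguments. -/
theorem inner_hankel (hα : ∀ m, 0 < (α m).re) (hdeg : ∀ m, (Q m).natDegree ≤ K m)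
    {H : hardyPlus →L[ℂ] hardyPlus} (hH : IsHankelWithSymbol (rationalSymbol α K Q) H)
    (w v : hardyPlus) : inner ℂ v (H w) = symbolForm α K Q w (reflect v) := by
  rw [← sub_eq_zero]
  have hr : ∀ w v u : hardyPlus, symbolForm α K Q w (v + u) =
      symbolForm α K Q w v + symbolForm α K Q w u := fun w v u => by
    simp only [symbolForm_comm w, symbolForm_add hα hdeg]
  have hsr : ∀ (c : ℂ) (w u : hardyPlus), symbolForm α K Q w (c • u) =
      c * symbolForm α K Q w u := fun c w u => by
    simp only [symbolForm_comm w, symbolForm_smul]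
  refine sesquilinear_eq_zero (fun w v => inner ℂ v (H w) - symbolForm α K Q w (reflect v))
    ?_ ?_ ?_ ?_ ?_ w v
  · intro w v u
    simp only [map_add, inner_add_right, symbolForm_add hα hdeg]
    ring
  · intro w v u
    simp only [reflect_add, inner_add_left, hr]
    ring
  · intro c w u
    have h : inner ℂ u (H (c • w)) = c * inner ℂ u (H w) := by
      rw [map_smul]
      exact inner_smul_right u (H w) c
    simp only [h, symbolForm_smul]
    ring
  · intro c w u
    simp only [reflect_smul, inner_smul_left, hsr]
    ring
  · intro w
    rw [sub_eq_zero, hH.form_eq, symbolForm, ← integral_neg_eq_self]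
    refine integral_congr_ae ?_
    filter_upwards [coeFn_reflect w] with x hx
    rw [hx, neg_neg, mul_assoc]

end Form

theorem neg_conj_I_mul (z : ℂ) :
    -starRingEnd ℂ (Complex.I * z) = Complex.I * starRingEnd ℂ z := by
  simp

/-! ### Conjugation symmetry of the poles. -/

section Conjugation

variable {M : ℕ} {α : Fin M → ℂ} {K : Fin M → ℕ} {Q : Fin M → ℂ[X]} {σ : Fin M → Fin M}

theorem involutive_of_conj (hαinj : Function.Injective α)
    (hσ : ∀ m, α (σ m) = starRingEnd ℂ (α m)) : Function.Involutive σ := fun m =>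
  hαinj (by rw [hσ, hσ, Complex.conj_conj])

/-- Reflection sends the zero iα_m to i conj α_m = iα_{σm}, so it merely permutes the orders. -/
theorem conj_mobiusProd (hαinj : Function.Injective α)
    (hσ : ∀ m, α (σ m) = starRingEnd ℂ (α m)) (o : Fin M → ℕ) (z : ℂ) :
    starRingEnd ℂ (mobiusProd α o (-starRingEnd ℂ z)) = mobiusProd α (o ∘ σ) z := by
  have hinv := involutive_of_conj hαinj hσ
  rw [mobiusProd, mobiusProd, map_prod, ← Equiv.prod_comp (hinv.toPerm σ)]
  refine Finset.prod_congr rfl fun m _ => ?_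
  rw [map_pow, mobius_reflect, neg_conj_I_mul]
  simp only [Function.Involutive.coe_toPerm, Function.comp_apply]
  rw [← hσ, hinv m]

theorem reflect_mulProd (hαinj : Function.Injective α)
    (hσ : ∀ m, α (σ m) = starRingEnd ℂ (α m)) (o : Fin M → ℕ) (w : hardyPlus) :
    reflect (mulProd α o w) = mulProd α (o ∘ σ) (reflect w) := by
  refine reflect_mulBy _ _ (fun x => ?_) w
  rw [← conj_mobiusProd hαinj hσ o x, Complex.conj_ofReal]
  push_cast
  rfl

variable (hα : ∀ m, 0 < (α m).re) (hαinj : Function.Injective α)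
  (hdeg : ∀ m, (Q m).natDegree ≤ K m) (hQ : ∀ m, (Q m).eval (-Complex.I * α m) ≠ 0)
  (herm : ∀ w v : hardyPlus, symbolForm α K Q w (reflect v) =
    starRingEnd ℂ (symbolForm α K Q v (reflect w)))

include hα hαinj hdeg hQ herm

/-- Let v vanish to full order at every pole and let w lack one zero at iα_μ. Then v makes one side
of the symmetry relation zero. The other side is a residue at iα_μ containing conj v(i conj α_μ),
which is nonzero if conj α_μ is not among the parameters. -/
theorem exists_conj_pole (μ : Fin M) : ∃ m, α m = starRingEnd ℂ (α μ) := by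
  by_contra! hne
  have ha := I_mul_im_pos (hα μ)
  have ha' : 0 < (-starRingEnd ℂ (Complex.I * α μ)).im := by simpa using hα μ
  set o : Fin M → ℕ := Function.update (fun m => K m + 1) μ (K μ) with ho
  have h := herm (mulProd α o base) (mulProd α (fun m => K m + 1) base)
  rw [symbolForm_mulProd_eq_zero hα hdeg (fun m => Nat.lt_succ_self _), map_zero,
    symbolForm_mulProd_single hα hdeg (μ := μ) (by simp [ho]) (fun m hm => by simp [ho, hm]),
    extension_reflect _ ha, mulProd, extension_mulBy _ _ ha'] at h
  refine mul_ne_zero (poleCoeff_ne_zero (hα μ) (hQ μ)) (mul_ne_zero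
    (prod_mobius_ne_zero hα hαinj o μ) (mul_ne_zero (extension_base_ne_zero ha)
      ((_root_.map_ne_zero _).2 (mul_ne_zero ?_ (extension_base_ne_zero ha'))))) h
  refine Finset.prod_ne_zero_iff.2 fun n _ => pow_ne_zero _ (mobius_ne_zero ha'.le fun h0 => ?_)
  rw [neg_conj_I_mul] at h0
  exact hne n (mul_left_cancel₀ Complex.I_ne_zero h0).symm

omit hα hdeg hQ in
theorem symbolForm_mulProd_reflect (hσ : ∀ m, α (σ m) = starRingEnd ℂ (α m)) (o : Fin M → ℕ)
    (w v : hardyPlus) : symbolForm α K Q (mulProd α o w) (reflect v) =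
      starRingEnd ℂ (symbolForm α K Q (mulProd α (o ∘ σ) v) (reflect w)) := by
  rw [herm, reflect_mulProd hαinj hσ, symbolForm_mulProd_right]

theorem order_le_conj (hσ : ∀ m, α (σ m) = starRingEnd ℂ (α m)) (μ : Fin M) :
    K μ ≤ K (σ μ) := by
  by_contra! hlt
  have hinv := involutive_of_conj hαinj hσ
  have ha := I_mul_im_pos (hα μ)
  have ha' : 0 < (-starRingEnd ℂ (Complex.I * α μ)).im := by simpa using hα μ
  have hK : ∀ m, K m < ∑ n, K n + 1 := fun m =>
    Nat.lt_succ_of_le (Finset.single_le_sum (fun _ _ => Nat.zero_le _) (Finset.mem_univ m))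
  -- The common value ∑ K + 1 exceeds every K_m, so it still gives full vanishing after σ permutes
  -- the orders. The entry K_μ moves to σμ, where it would exceed K_{σμ} and make the right side
  -- zero, while the left side is a nonzero residue.
  set o : Fin M → ℕ := Function.update (fun _ => ∑ n, K n + 1) μ (K μ) with ho
  have h := symbolForm_mulProd_reflect hαinj herm hσ o base base
  rw [symbolForm_mulProd_eq_zero hα hdeg (o := o ∘ σ) (fun m => ?_), map_zero,
    symbolForm_mulProd_single hα hdeg (μ := μ) (by simp [ho]) (fun m hm => by simp [ho, hm, hK]),
    extension_reflect _ ha] at h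
  · exact mul_ne_zero (poleCoeff_ne_zero (hα μ) (hQ μ)) (mul_ne_zero
      (prod_mobius_ne_zero hα hαinj o μ) (mul_ne_zero (extension_base_ne_zero ha)
        ((_root_.map_ne_zero _).2 (extension_base_ne_zero ha')))) h
  · rcases eq_or_ne (σ m) μ with hm | hm
    · have : m = σ μ := by rw [← hm, hinv m]
      subst this
      simpa [ho, hm] using hlt
    · simp [ho, hm, hK]

theorem order_eq_conj (hσ : ∀ m, α (σ m) = starRingEnd ℂ (α m)) (μ : Fin M) :
    K (σ μ) = K μ := by
  refine le_antisymm ?_ (order_le_conj hα hαinj hdeg hQ herm hσ μ)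
  have := order_le_conj hα hαinj hdeg hQ herm hσ (σ μ)
  rwa [involutive_of_conj hαinj hσ μ] at this

omit hα hQ hdeg herm in
-- For real α_μ the point iα_μ is fixed by reflection, so conjugation only permutes the factors.
theorem conj_prod_mobius (hσ : ∀ m, α (σ m) = starRingEnd ℂ (α m)) {μ : Fin M}
    (hμ : (α μ).im = 0) (o : Fin M → ℕ) :
    starRingEnd ℂ (∏ n ∈ Finset.univ.erase μ, mobius (Complex.I * α n) (Complex.I * α μ) ^ o n) =
      ∏ n ∈ Finset.univ.erase μ, mobius (Complex.I * α n) (Complex.I * α μ) ^ o (σ n) := by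
  have hinv := involutive_of_conj hαinj hσ
  have hc : starRingEnd ℂ (α μ) = α μ := Complex.conj_eq_iff_im.2 hμ
  have hσμ : σ μ = μ := hαinj (by rw [hσ, hc])
  rw [map_prod]
  refine Finset.prod_bij (fun n _ => σ n) (fun n hn => ?_) (fun _ _ _ _ h => hinv.injective h)
    (fun n hn => ⟨σ n, ?_, hinv n⟩) (fun n _ => ?_)
  · rw [Finset.mem_erase] at hn ⊢
    exact ⟨fun h => hn.1 (hinv.injective (by rw [h, hσμ])), Finset.mem_univ _⟩
  · rw [Finset.mem_erase] at hn ⊢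
    exact ⟨fun h => hn.1 (hinv.injective (by rw [h, hσμ])), Finset.mem_univ _⟩
  · have h := mobius_reflect (Complex.I * α n) (Complex.I * α μ)
    rw [neg_conj_I_mul, neg_conj_I_mul, hc, ← hσ] at h
    rw [map_pow, h, hinv n]

/-- With orders invariant under σ, both sides of the symmetry relation are the same nonzero number
times the coefficient and its conjugate respectively. -/
theorem poleCoeff_im_eq_zero (hσ : ∀ m, α (σ m) = starRingEnd ℂ (α m)) {μ : Fin M}
    (hμ : (α μ).im = 0) : (poleCoeff (α μ) (K μ) (Q μ)).im = 0 := by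
  have hinv := involutive_of_conj hαinj hσ
  have ha := I_mul_im_pos (hα μ)
  have hc : starRingEnd ℂ (α μ) = α μ := Complex.conj_eq_iff_im.2 hμ
  have hσμ : σ μ = μ := hαinj (by rw [hσ, hc])
  set o : Fin M → ℕ := Function.update (fun m => K m + 1) μ (K μ) with ho
  have hoσ : o ∘ σ = o := by
    funext m
    rcases eq_or_ne m μ with rfl | hm
    · simp [hσμ]
    · have : σ m ≠ μ := fun h => hm (hinv.injective (by rw [h, hσμ]))
      simp [ho, this, hm, order_eq_conj hα hαinj hdeg hQ herm hσ m]
  have h := symbolForm_mulProd_reflect hαinj herm hσ o base base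
  rw [hoσ, symbolForm_mulProd_single hα hdeg (μ := μ) (by simp [ho])
    (fun m hm => by simp [ho, hm]), extension_reflect _ ha, neg_conj_I_mul, hc, map_mul, map_mul,
    map_mul, Complex.conj_conj, conj_prod_mobius hαinj hσ hμ,
    mul_comm (starRingEnd ℂ (extension base _))] at h
  change _ * (_ * _) = _ * ((∏ n ∈ Finset.univ.erase μ,
    mobius (Complex.I * α n) (Complex.I * α μ) ^ ((o ∘ σ) n)) * _) at h
  rw [hoσ] at h
  have hX := mul_ne_zero (prod_mobius_ne_zero hα hαinj o μ) (mul_ne_zero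
    (extension_base_ne_zero ha) ((_root_.map_ne_zero (starRingEnd ℂ)).2 (extension_base_ne_zero ha)))
  exact Complex.conj_eq_iff_im.1 (mul_right_cancel₀ hX h).symm

end Conjugation

/-! ### Sign of the residue at a real pole. -/

section RealPole

/-- At a real pole, the leading residue is a real multiple of the value of the numerator. -/
theorem exists_poleCoeff_eq {α : ℂ} (hα : 0 < α.re) (him : α.im = 0) (K : ℕ) (Q : ℂ[X]) :
    ∃ t : ℝ, t ≠ 0 ∧ (Even K → 0 < t) ∧
      poleCoeff α K Q = t * Q.eval (-Complex.I * α) := by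
  have ha := I_mul_im_pos hα
  have hre : (Complex.I * α).re = 0 := by simpa using him
  set c := (residueConst (Complex.I * α)).im with hc
  have hcpos : 0 < c := residueConst_im_pos ha
  have hR : residueConst (Complex.I * α) = c * Complex.I := by
    refine Complex.ext ?_ ?_
    · simp [residueConst_re ha hre]
    · simp [hc]
  have hαr : α = (α.re : ℂ) := Complex.ext (by simp) (by simp [him])
  have hs : 0 < α.re + 1 := by linarith
  have hpow : (0 : ℝ) < c / (α.re + 1) ^ K := by positivity
  -- From ci (-i)^{K+1} / (i(α+1))^K = (-1)^K c/(α+1)^K, where c > 0 is the imaginary part of the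
  -- residue constant.
  refine ⟨(-1) ^ K * (c / (α.re + 1) ^ K), mul_ne_zero (pow_ne_zero _ (by norm_num)) hpow.ne',
    fun he => by rw [he.neg_one_pow, one_mul]; exact hpow, ?_⟩
  have hden : Complex.I * α + Complex.I = Complex.I * ((α.re + 1 : ℝ) : ℂ) := by
    conv_lhs => rw [hαr]
    push_cast
    ring
  have hs' : ((α.re + 1 : ℝ) : ℂ) ≠ 0 := by exact_mod_cast hs.ne'
  rw [poleCoeff, hR, hden, mul_pow, pow_succ, neg_pow Complex.I K]
  have hI := Complex.I_ne_zero
  push_cast at hs' ⊢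
  field_simp
  rw [Complex.I_sq]
  ring

end RealPole

/-! ### Kernel, rank and semidefinite subspaces. -/

section Kernel

variable {M : ℕ} {α : Fin M → ℂ} {K : Fin M → ℕ} {Q : Fin M → ℂ[X]}

theorem ker_hankel_eq (hα : ∀ m, 0 < (α m).re) (hαinj : Function.Injective α)
    (hdeg : ∀ m, (Q m).natDegree ≤ K m) (hQ : ∀ m, (Q m).eval (-Complex.I * α m) ≠ 0)
    {H : hardyPlus →L[ℂ] hardyPlus} (hH : IsHankelWithSymbol (rationalSymbol α K Q) H) :
    LinearMap.ker (H : hardyPlus →ₗ[ℂ] hardyPlus) =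
      LinearMap.range (mulProd α fun m => K m + 1) := by
  have hform : ∀ w : hardyPlus, H w = 0 ↔ ∀ u, symbolForm α K Q w u = 0 := by
    intro w
    constructor
    · intro h u
      have := inner_hankel hα hdeg hH w (reflect u)
      rw [reflect_reflect, h, inner_zero_right] at this
      exact this.symm
    · intro h
      refine inner_self_eq_zero (𝕜 := ℂ).1 ?_
      rw [inner_hankel hα hdeg hH, h]
  -- Induction on the number of zeros still missing: each round shows that the cofactor w vanishes
  -- at some iα_μ and splits off one more Möbius factor.
  have key : ∀ (d : ℕ) (o : Fin M → ℕ) (w : hardyPlus), (∀ m, o m ≤ K m + 1) →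
      ∑ m, (K m + 1 - o m) = d → H (mulProd α o w) = 0 →
      mulProd α o w ∈ LinearMap.range (mulProd α fun m => K m + 1) := by
    intro d
    induction d with
    | zero =>
      intro o w ho hd _
      have : o = fun m => K m + 1 := by
        funext m
        have := (Finset.sum_eq_zero_iff.1 hd) m (Finset.mem_univ m)
        have := ho m
        omega
      exact this ▸ ⟨w, rfl⟩
    | succ d ih =>
      intro o w ho hd h0
      obtain ⟨μ, hμ⟩ : ∃ μ, o μ < K μ + 1 := by
        by_contra! hcon
        rw [Finset.sum_eq_zero fun m _ => Nat.sub_eq_zero_of_le (hcon m)] at hd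
        omega
      have ha := I_mul_im_pos (hα μ)
      -- The test function raises the total order to K_μ at μ and K_m + 1 elsewhere, leaving one
      -- residue that is a nonzero multiple of w(iα_μ).
      have h1 := (hform _).1 h0
        (mulProd α (Function.update (fun m => K m + 1 - o m) μ (K μ - o μ)) base)
      rw [symbolForm_mulProd_right, ← LinearMap.comp_apply, ← mulProd_add,
        symbolForm_mulProd_single hα hdeg (μ := μ) (by simp; omega) (fun m hm => by
          have := ho m
          simp [hm]
          omega)] at h1
      have hw : extension w (Complex.I * α μ) = 0 := by
        by_contra hne
        exact mul_ne_zero (poleCoeff_ne_zero (hα μ) (hQ μ)) (mul_ne_zero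
          (prod_mobius_ne_zero hα hαinj _ μ) (mul_ne_zero hne (extension_base_ne_zero ha))) h1
      have hw' : w ∈ LinearMap.range (mulBy (isMultiplier_mobius (Complex.I * α μ))) := by
        rw [range_mulBy_mobius ha]
        exact hw
      obtain ⟨v, rfl⟩ := hw'
      rw [← mulProd_single, ← LinearMap.comp_apply, ← mulProd_add] at h0 ⊢
      refine ih _ v (fun m => ?_) ?_ h0
      · rcases eq_or_ne m μ with rfl | hm
        · simp; omega
        · simpa [hm] using ho m
      · have h2 := Finset.add_sum_erase Finset.univ (fun m => K m + 1 - o m) (Finset.mem_univ μ)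
        rw [← Finset.add_sum_erase Finset.univ _ (Finset.mem_univ μ)]
        have h3 : ∑ m ∈ Finset.univ.erase μ, (K m + 1 - (o + Pi.single μ 1 : Fin M → ℕ) m) =
            ∑ m ∈ Finset.univ.erase μ, (K m + 1 - o m) :=
          Finset.sum_congr rfl fun m hm => by simp [Finset.ne_of_mem_erase hm]
        rw [h3]
        simp only [Pi.add_apply, Pi.single_eq_same]
        omega
  ext w
  rw [LinearMap.mem_ker]
  constructor
  · intro h
    have h1 : mulProd α 0 w = w := by
      rw [mulProd, mulBy_one _ fun x => by simp [mobiusProd], LinearMap.id_apply]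
    have h2 := key _ 0 w (fun m => Nat.zero_le _) rfl (by rw [h1]; exact h)
    rwa [h1] at h2
  · rintro ⟨v, rfl⟩
    exact (hform _).2 fun u => symbolForm_mulProd_eq_zero hα hdeg (fun m => Nat.lt_succ_self _) v u

theorem finrank_range_hankel (hα : ∀ m, 0 < (α m).re) (hαinj : Function.Injective α)
    (hdeg : ∀ m, (Q m).natDegree ≤ K m) (hQ : ∀ m, (Q m).eval (-Complex.I * α m) ≠ 0)
    {H : hardyPlus →L[ℂ] hardyPlus} (hH : IsHankelWithSymbol (rationalSymbol α K Q) H) :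
    Module.Finite ℂ (LinearMap.range (H : hardyPlus →ₗ[ℂ] hardyPlus)) ∧
    Module.finrank ℂ (LinearMap.range (H : hardyPlus →ₗ[ℂ] hardyPlus)) = ∑ m, (K m + 1) := by
  have hr := (LinearMap.quotKerEquivRange (H : hardyPlus →ₗ[ℂ] hardyPlus)).rank_eq
  rw [ker_hankel_eq hα hαinj hdeg hQ hH, rank_quotient_range_mulProd hα] at hr
  refine ⟨?_, Module.finrank_eq_of_rank_eq hr.symm⟩
  rw [← Module.rank_lt_aleph0_iff, ← hr]
  exact Cardinal.natCast_lt_aleph0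

/-- For x = B_o w the reflected copy supplies the orders o ∘ σ, so the total order at m is o_m +
o_{σm}. Where this equals K_m the pole is real, and both the Möbius product and w w* at iα_m become
squared moduli. -/
theorem hankel_form_nonneg (hα : ∀ m, 0 < (α m).re) (hαinj : Function.Injective α)
    (hdeg : ∀ m, (Q m).natDegree ≤ K m)
    {H : hardyPlus →L[ℂ] hardyPlus} (hH : IsHankelWithSymbol (rationalSymbol α K Q) H)
    {σ : Fin M → Fin M} (hσ : ∀ m, α (σ m) = starRingEnd ℂ (α m)) {o : Fin M → ℕ} {ε : ℝ}
    (ho : ∀ m, K m ≤ o m + o (σ m))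
    (hε : ∀ m, o m + o (σ m) = K m → (α m).im = 0 ∧
      (poleCoeff (α m) (K m) (Q m)).im = 0 ∧ 0 ≤ ε * (poleCoeff (α m) (K m) (Q m)).re) :
    ∀ x ∈ LinearMap.range (mulProd α o), 0 ≤ ε * (inner ℂ x (H x)).re := by
  rintro x ⟨w, rfl⟩
  rw [inner_hankel hα hdeg hH, reflect_mulProd hαinj hσ, symbolForm_mulProd_right,
    ← LinearMap.comp_apply, ← mulProd_add, symbolForm_mulProd hα hdeg, Complex.re_sum,
    Finset.mul_sum]
  · refine Finset.sum_nonneg fun m hm => ?_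
    have hm' : o m + o (σ m) = K m := by
      rw [← (Finset.mem_filter.1 hm).2]
      simp [add_comm]
    obtain ⟨him, hγ, hpos⟩ := hε m hm'
    have hc : starRingEnd ℂ (α m) = α m := Complex.conj_eq_iff_im.2 him
    rw [extension_reflect _ (I_mul_im_pos (hα m)), neg_conj_I_mul, hc, Complex.mul_conj]
    have hprod : ∏ n ∈ Finset.univ.erase m,
        mobius (Complex.I * α n) (Complex.I * α m) ^ (o ∘ σ + o) n =
        (Complex.normSq (∏ n ∈ Finset.univ.erase m,
          mobius (Complex.I * α n) (Complex.I * α m) ^ o n) : ℂ) := by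
      rw [Complex.normSq_eq_conj_mul_self, conj_prod_mobius hαinj hσ him,
        ← Finset.prod_mul_distrib]
      exact Finset.prod_congr rfl fun n _ => pow_add _ _ _
    rw [hprod, ← Complex.ofReal_mul, Complex.re_mul_ofReal, ← mul_assoc]
    exact mul_nonneg hpos (mul_nonneg (Complex.normSq_nonneg _) (Complex.normSq_nonneg _))
  · intro m
    simpa [add_comm] using ho m

end Kernel

/-! ### Arithmetic of the counts. -/

theorem realTermPos_add_realTermNeg {K : ℕ} {p : ℝ} (hp : p ≠ 0) :
    realTermPos K p + realTermNeg K p = K + 1 := by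
  unfold realTermPos realTermNeg
  rcases Nat.even_or_odd' K with ⟨k, rfl | rfl⟩
  · have : ¬ Odd (2 * k) := by simp
    rcases lt_or_gt_of_ne hp with h | h
    · simp only [this, if_false, h, if_true, not_lt.2 h.le]
      omega
    · have h' : 0 < p := h
      simp only [this, if_false, h', if_true, not_lt.2 h'.le]
      omega
  · simp only [odd_two_mul_add_one, if_true]
    omega

/-- A real pole is its own conjugate, so its order counts twice in the form. A surviving residue
requires 2r = K, hence K even, and `realTermNeg` permits this only when p is not negative. -/
theorem le_two_mul_realTermNeg {K : ℕ} {p : ℝ} :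
    K ≤ realTermNeg K p + realTermNeg K p ∧
      (realTermNeg K p + realTermNeg K p = K → Even K ∧ 0 ≤ p) := by
  unfold realTermNeg
  rcases Nat.even_or_odd' K with ⟨k, rfl | rfl⟩
  · have : ¬ Odd (2 * k) := by simp
    rcases lt_or_ge p 0 with h | h
    · simp only [this, if_false, h, if_true]
      omega
    · simp only [this, if_false, not_lt.2 h]
      exact ⟨by omega, fun _ => ⟨even_two_mul k, h⟩⟩
  · simp only [odd_two_mul_add_one, if_true]
    omega

theorem realTermPos_eq_realTermNeg (K : ℕ) (p : ℝ) : realTermPos K p = realTermNeg K (-p) := by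
  simp only [realTermPos, realTermNeg, Left.neg_neg_iff]

section Counting

variable {M : ℕ} {α : Fin M → ℂ} {K : Fin M → ℕ}

theorem sum_im_neg_eq_sum_im_pos (hαinj : Function.Injective α) {σ : Fin M → Fin M}
    (hσ : ∀ m, α (σ m) = starRingEnd ℂ (α m)) (hK : ∀ m, K (σ m) = K m) :
    ∑ m with (α m).im < 0, (K m + 1) = ∑ m with 0 < (α m).im, (K m + 1) := by
  have hinv := involutive_of_conj hαinj hσ
  refine Finset.sum_bij (fun n _ => σ n) (fun n hn => ?_) (fun _ _ _ _ h => hinv.injective h)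
    (fun n hn => ⟨σ n, ?_, hinv n⟩) (fun n _ => by rw [hK])
  · simpa [hσ] using hn
  · simpa [hσ] using hn

/-- Orders of vanishing which make the Hankel form semidefinite, given the orders at the real
poles. -/
noncomputable def vanishingOrder (α : Fin M → ℂ) (K r : Fin M → ℕ) (m : Fin M) : ℕ :=
  if (α m).im = 0 then r m else if 0 < (α m).im then 0 else K m + 1

theorem sum_vanishingOrder (hαinj : Function.Injective α) {σ : Fin M → Fin M}
    (hσ : ∀ m, α (σ m) = starRingEnd ℂ (α m)) (hK : ∀ m, K (σ m) = K m) (r : Fin M → ℕ) :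
    ∑ m, vanishingOrder α K r m = (∑ m with (α m).im = 0, r m) + (∑ m with 0 < (α m).im, K m) +
      (Finset.univ.filter fun m => 0 < (α m).im).card := by
  have h := sum_im_neg_eq_sum_im_pos hαinj hσ hK
  rw [Finset.sum_add_distrib (s := Finset.univ.filter fun m => 0 < (α m).im), Finset.sum_const,
    smul_eq_mul, mul_one] at h
  rw [add_assoc, ← h, Finset.sum_filter, Finset.sum_filter, ← Finset.sum_add_distrib]
  refine Finset.sum_congr rfl fun m _ => ?_
  unfold vanishingOrder
  rcases lt_trichotomy (α m).im 0 with h | h | h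
  · simp [h, h.ne, not_lt.2 h.le]
  · simp [h]
  · simp [h, h.ne', not_lt.2 h.le]

/-- A non-real pair shares K + 1 zeros, one above the threshold, so it drops out of the form. -/
theorem vanishingOrder_add {σ : Fin M → Fin M}
    (hαinj : Function.Injective α)
    (hσ : ∀ m, α (σ m) = starRingEnd ℂ (α m)) (hK : ∀ m, K (σ m) = K m) (r : Fin M → ℕ)
    (m : Fin M) : vanishingOrder α K r m + vanishingOrder α K r (σ m) =
      if (α m).im = 0 then r m + r m else K m + 1 := by
  unfold vanishingOrder
  rcases lt_trichotomy (α m).im 0 with h | h | h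
  · simp [h, h.ne, not_lt.2 h.le, hσ]
  · have : σ m = m := hαinj (by rw [hσ, Complex.conj_eq_iff_im.2 h])
    simp [h, this]
  · simp [h, h.ne', not_lt.2 h.le, hσ, hK]

end Counting

theorem theorem5p1 {M : ℕ} (α : Fin M → ℂ) (K : Fin M → ℕ) (Q : Fin M → ℂ[X])
    (hα : ∀ m, 0 < (α m).re) (hαinj : Function.Injective α)
    (hdeg : ∀ m, (Q m).natDegree ≤ K m)
    (hQ : ∀ m, (Q m).eval (-Complex.I * α m) ≠ 0)
    (H : hardyPlus →L[ℂ] hardyPlus)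
    (hH : IsHankelWithSymbol (rationalSymbol α K Q) H)
    (hsa : (H : hardyPlus →ₗ[ℂ] hardyPlus).IsSymmetric) :
    (∀ m, (α m).im = 0 → ((Q m).eval (-Complex.I * α m)).im = 0) ∧
    numPosEigenvalues (H : hardyPlus →ₗ[ℂ] hardyPlus) =
      (((∑ m with (α m).im = 0, realTermPos (K m) ((Q m).eval (-Complex.I * α m)).re)
        + (∑ m with 0 < (α m).im, K m)
        + (Finset.univ.filter (fun m => 0 < (α m).im)).card : ℕ) : ℕ∞) ∧
    numNegEigenvalues (H : hardyPlus →ₗ[ℂ] hardyPlus) =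
      (((∑ m with (α m).im = 0, realTermNeg (K m) ((Q m).eval (-Complex.I * α m)).re)
        + (∑ m with 0 < (α m).im, K m)
        + (Finset.univ.filter (fun m => 0 < (α m).im)).card : ℕ) : ℕ∞) := by
  have herm : ∀ w v : hardyPlus, symbolForm α K Q w (reflect v) =
      starRingEnd ℂ (symbolForm α K Q v (reflect w)) := by
    intro w v
    rw [← inner_hankel hα hdeg hH, ← inner_hankel hα hdeg hH]
    exact (hsa v w).symm.trans (inner_conj_symm _ _).symm
  choose σ hσ using exists_conj_pole hα hαinj hdeg hQ herm
  have hK := order_eq_conj hα hαinj hdeg hQ herm hσ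
  obtain ⟨p, hp⟩ : ∃ p : Fin M → ℝ, ∀ m, ((Q m).eval (-Complex.I * α m)).re = p m :=
    ⟨_, fun _ => rfl⟩
  simp only [hp]
  have hreal : ∀ m, (α m).im = 0 → ((Q m).eval (-Complex.I * α m)).im = 0 := by
    intro m hm
    obtain ⟨t, ht, -, h⟩ := exists_poleCoeff_eq (hα m) hm (K m) (Q m)
    have h1 := poleCoeff_im_eq_zero hα hαinj hdeg hQ herm hσ hm
    rw [h, Complex.im_ofReal_mul] at h1
    exact (mul_eq_zero.1 h1).resolve_left ht
  have hp0 : ∀ m, (α m).im = 0 → p m ≠ 0 := fun m hm h0 =>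
    hQ m (Complex.ext ((hp m).trans h0) (hreal m hm))
  -- The value ε = 1 bounds the negative eigenvalues and ε = -1 the positive ones; the sign change p
  -- ↦ -p exchanges the two counts.
  have bound : ∀ (ε : ℝ) (S : Set ℝ), (∀ μ ∈ S, ε * μ < 0) →
      eigenvalueCount (H : hardyPlus →ₗ[ℂ] hardyPlus) S ≤
        ((∑ m, vanishingOrder α K (fun m => realTermNeg (K m) (ε * p m)) m : ℕ) : ℕ∞) := by
    intro ε S hS
    rw [← finrank_quotient_range_mulProd hα]
    have := finite_quotient_range_mulProd hα
      (vanishingOrder α K (fun m => realTermNeg (K m) (ε * p m)))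
    refine eigenvalueCount_le_finrank_quotient hsa hS _
      (hankel_form_nonneg hα hαinj hdeg hH hσ (fun m => ?_) fun m hm => ?_)
    · rw [vanishingOrder_add hαinj hσ hK]
      split_ifs with h
      · exact le_two_mul_realTermNeg.1
      · exact Nat.le_succ _
    · rw [vanishingOrder_add hαinj hσ hK] at hm
      split_ifs at hm with h
      · obtain ⟨heven, hpos⟩ := le_two_mul_realTermNeg.2 hm
        obtain ⟨t, -, ht, hγ⟩ := exists_poleCoeff_eq (hα m) h (K m) (Q m)
        refine ⟨h, poleCoeff_im_eq_zero hα hαinj hdeg hQ herm hσ h, ?_⟩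
        rw [hγ, Complex.re_ofReal_mul, hp, mul_left_comm]
        exact mul_nonneg (ht heven).le hpos
      · omega
  have hneg := bound 1 (Set.Iio 0) (fun μ hμ => by simpa using hμ)
  have hpos := bound (-1) (Set.Ioi 0) (fun μ hμ => by simpa using hμ)
  simp only [one_mul, neg_one_mul, ← realTermPos_eq_realTermNeg] at hneg hpos
  obtain ⟨hfin, hrank⟩ := finrank_range_hankel hα hαinj hdeg hQ hH
  have htotal := finrank_range_le_eigenvalueCount_add hsa
  have hsum : ∑ m, (K m + 1) = ∑ m, vanishingOrder α K (fun m => realTermPos (K m) (p m)) m +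
      ∑ m, vanishingOrder α K (fun m => realTermNeg (K m) (p m)) m := by
    have h1 := sum_im_neg_eq_sum_im_pos hαinj hσ hK
    rw [sum_vanishingOrder hαinj hσ hK, sum_vanishingOrder hαinj hσ hK]
    have h2 : ∑ m, (K m + 1) = ∑ m with (α m).im = 0, (K m + 1) +
        (∑ m with 0 < (α m).im, (K m + 1) + ∑ m with (α m).im < 0, (K m + 1)) := by
      simp only [Finset.sum_filter, ← Finset.sum_add_distrib]
      refine Finset.sum_congr rfl fun m _ => ?_
      rcases lt_trichotomy (α m).im 0 with h | h | h
      · simp [h, h.ne, not_lt.2 h.le]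
      · simp [h]
      · simp [h, h.ne', not_lt.2 h.le]
    have h3 : ∑ m with (α m).im = 0, (K m + 1) =
        ∑ m with (α m).im = 0, realTermPos (K m) (p m) +
        ∑ m with (α m).im = 0, realTermNeg (K m) (p m) := by
      rw [← Finset.sum_add_distrib]
      exact Finset.sum_congr rfl fun m hm =>
        (realTermPos_add_realTermNeg (hp0 m (Finset.mem_filter.1 hm).2)).symm
    have h4 : ∑ m with 0 < (α m).im, (K m + 1) = ∑ m with 0 < (α m).im, K m +
        (Finset.univ.filter fun m => 0 < (α m).im).card := by
      rw [Finset.sum_add_distrib, Finset.sum_const, smul_eq_mul, mul_one]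
    omega
  -- The rank, now the sum of the two upper bounds, is at most N_+ + N_-. The bounds are finite, so
  -- both must be attained.
  rw [hrank, hsum] at htotal
  rw [← sum_vanishingOrder hαinj hσ hK, ← sum_vanishingOrder hαinj hσ hK]
  refine ⟨hreal, ?_⟩
  unfold numPosEigenvalues numNegEigenvalues
  generalize eigenvalueCount (H : hardyPlus →ₗ[ℂ] hardyPlus) (Set.Ioi 0) = a at *
  generalize eigenvalueCount (H : hardyPlus →ₗ[ℂ] hardyPlus) (Set.Iio 0) = b at *
  lift a to ℕ using ne_top_of_le_ne_top (ENat.natCast_ne_top _) hpos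
  lift b to ℕ using ne_top_of_le_ne_top (ENat.natCast_ne_top _) hneg
  norm_cast at *
  omega
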